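/- **Setting.** Let $\Lambda=\mathcal K\mathcal Q/\langle\rho\rangle$ be a string algebra: $\mathcal Q=(Q_0,Q_1,s,t)$ is a finite quiver in which every vertex has indegree and outdegree at most two; $\rho$ is a set of paths of length at least $2$, none of which is a proper subpath of another, generating an admissible ideal; for every arrow $a$ there is at most one arrow $b$ with $s(b)=t(a)$, $ba\notin\langle\rho\rangle$, and at most one arrow $b$ with $t(b)=s(a)$, $ab\notin\langle\rho\rangle$. Fix maps $\sigma,\varepsilon:Q_1\to\{1,-1\}$ such that distinct arrows with the same source (resp. target) have opposite values of $\sigma$ (resp. $\varepsilon$), and $\sigma(b)=-\varepsilon(a)$ whenever $t(a)=s(b)$ and $ba\notin\langle\rho\rangle$. **Strings.** Syllables are arrows $a$ (direct) and their formal inverses $A=a^{-1}$ (inverse), with $s(A)=t(a)$, $t(A)=s(a)$, $\sigma(A)=\varepsilon(a)$, $\varepsilon(A)=\sigma(a)$. A string is either a zero-length string $1_{(v,i)}$ ($v\in Q_0$, $i=\pm1$), or a sequence $\alpha_n\cdots\alpha_1$ ($n\ge1$) of syllables with $s(\alpha_{j+1})=t(\alpha_j)$, without two consecutive mutually inverse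 syllables, and without a subpath in $\rho\cup\rho^{-1}$. Put $s(\alpha_n\cdots\alpha_1)=s(\alpha_1)$, $\sigma(\alpha_n\cdots\alpha_1)=\sigma(\alpha_1)$, $t(\alpha_n\cdots\alpha_1)=t(\alpha_n)$, $\varepsilon(\alpha_n\cdots\alpha_1)=\varepsilon(\alpha_n)$; $s(1_{(v,i)})=t(1_{(v,i)})=v$ and $\sigma(1_{(v,i)})=-\varepsilon(1_{(v,i)})=-i$; $1_{(v,i)}^{-1}=1_{(v,-i)}$. The product $1_{(v,i)}\mathfrak u=\mathfrak u$ is defined if $t(\mathfrak u)=v$, $\varepsilon(\mathfrak u)=i$, and $\mathfrak u1_{(v,i)}=\mathfrak u$ is defined if $s(\mathfrak u)=v$, $\sigma(\mathfrak u)=-i$. A left (resp. right) $\mathbb N$-string is an infinite sequence $\cdots\alpha_2\alpha_1$ (resp. $\alpha_1\alpha_2\cdots$) of syllables all of whose finite parts $\alpha_n\cdots\alpha_1$ (resp. $\alpha_1\cdots\alpha_n$) are strings. **Bands.** A band is a string $\mathfrak b=\alpha_n\cdots\alpha_1$ with $\alpha_n$ direct and $\alpha_1$ inverse such that $\mathfrak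 b^2$ is a string and $\mathfrak b$ is not an $m$-th power of a string with $m\ge2$. Let $\mathcal Q^{\mathrm{Ba}}_0$ be a set of representatives of the bands up to cyclic permutation; a cycle is a cyclic permutation of an element of $\mathcal Q_0^{\mathrm{Ba}}$. For $\mathfrak b_1,\mathfrak b_2\in\mathcal Q^{\mathrm{Ba}}_0$ write $\mathfrak b_1\preceq\mathfrak b_2$ if $\mathfrak b_2\mathfrak u\mathfrak b_1$ is a string for some string $\mathfrak u$, and let $\mathcal Q^{\mathrm{Ba}}$ be the set of classes of the equivalence relation ${\preceq}\cap{\succeq}$. For a cycle $\mathfrak b$ put ${}^\infty\mathfrak b=\cdots\mathfrak b\mathfrak b$ and $\mathfrak b^\infty=\mathfrak b\mathfrak b\cdots$. **Orders.** For finite or left infinite strings, $\mathfrak x<_l\mathfrak y$ means that after their maximal common right-hand part $\mathfrak w$ (read from the right) either $\mathfrak x=\mathfrak w$ and $\mathfrak y$ continues with an inverse syllable, or $\mathfrak y=\mathfrak w$ and $\mathfrak x$ continues with a direct syllable, or $\mathfrak x$ continues with a direct and $\mathfrak y$ with an inverse syllable. Also $\mathfrak x<_r\mathfrak y$ means $\mathfrak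 x^{-1}<_l\mathfrak y^{-1}$. For $\mathsf B\in\mathcal Q^{\mathrm{Ba}}$ let $\mathsf{Ba}_l(\mathsf B)$ (resp. $\mathsf{Ba}_{\bar l}(\mathsf B)$) be the set of all $\mathfrak b\in\mathsf B$ such that for all $\mathfrak b'\in\mathsf B$ and all strings $\mathfrak u$ for which $\mathfrak b'\mathfrak u\mathfrak b$ is a string, ${}^\infty\mathfrak b\le_l{}^\infty\mathfrak b'\mathfrak u\mathfrak b$ (resp. ${}^\infty\mathfrak b'\mathfrak u\mathfrak b\le_l{}^\infty\mathfrak b$). **Hammocks.** For a vertex $v$, let $H_l$ be the set of strings $\mathfrak u$ with $s(\mathfrak u)=v$, $\sigma(\mathfrak u)=-1$, and $H_r$ the set of strings $\mathfrak w$ with $t(\mathfrak w)=v$, $\varepsilon(\mathfrak w)=1$, ordered by $<_l$ and $<_r$; $\widehat H_l\supseteq H_l$ and $\widehat H_r\supseteq H_r$ are obtained by adding the left, resp. right, $\mathbb N$-strings satisfying the same conditions. Let $H(v)=\{(\mathfrak u,\mathfrak w)\in H_l\times H_r:\mathfrak u\mathfrak w\text{ is a string}\}$ with the product order, let $\mathsf{Cyc}(v)$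 be the set of cycles $\mathfrak b$ with $s(\mathfrak b)=t(\mathfrak b)=v$ and $\varepsilon(\mathfrak b)=1=-\sigma(\mathfrak b)$, and let $\overline H(v)=H(v)\cup\{({}^\infty\mathfrak b,\mathfrak b^\infty):\mathfrak b\in\mathsf{Cyc}(v)\}$. A box is a subset $\mathcal I\subseteq H(v)$ whose projections $\pi_l(\mathcal I)$, $\pi_r(\mathcal I)$ are intervals (convex subsets) of $H_l$, $H_r$ and with $\mathcal I=H(v)\cap(\pi_l(\mathcal I)\times\pi_r(\mathcal I))$; it is scattered if the order $\mathbb Q$ does not embed into it. The closure of an interval $I\subseteq H_l$ is $\widehat I=\{\mathfrak z\in\widehat H_l:[\mathfrak z,\mathfrak z']\cup[\mathfrak z',\mathfrak z]\subseteq I\text{ for some }\mathfrak z'\in I\}$, where $[\cdot,\cdot]$ denotes intervals in $H_l$; similarly for $H_r$. The closure of a box $\mathcal I$ is $\overline{\mathcal I}=\mathcal I\cup\{({}^\infty\mathfrak b,\mathfrak b^\infty)\in\overline H(v):{}^\infty\mathfrak b\in\widehat{\pi_l(\mathcal I)},\ \mathfrak b^\infty\in\widehat{\pi_r(\mathcal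 I)}\}$. A point $({}^\infty\mathfrak b,\mathfrak b^\infty)\in\overline H(v)$ is exceptional if it lies in $\overline{\mathcal I}$ for some scattered box $\mathcal I\subseteq H(v)$. **Lemma.** Let $v\in Q_0$. 1. The set $\bigcup_{\mathsf B\in\mathcal Q^{\mathrm{Ba}}}\left(\mathsf{Ba}_l(\mathsf B)\cup\mathsf{Ba}_{\bar l}(\mathsf B)\right)$ is finite. 2. Let $\mathfrak b_1\in\mathsf{Cyc}(v)$ be a cyclic permutation of $\mathfrak b\in\mathcal Q^{\mathrm{Ba}}_0$. If $({}^\infty\mathfrak b_1,\mathfrak b_1^\infty)$ is exceptional, then $\mathfrak b\in\bigcup_{\mathsf B\in\mathcal Q^{\mathrm{Ba}}}\left(\mathsf{Ba}_l(\mathsf B)\cup\mathsf{Ba}_{\bar l}(\mathsf B)\right)$. 3. The set of exceptional points in $\overline H(v)\setminus H(v)$ is finite. -/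

import Mathlib

open scoped Stream'

/-! ### Syllables and string algebras -/

/-- The syllables over a set `A` of arrows: arrows `a` (direct syllables) and their formal
inverses (inverse syllables). -/
inductive Syllable (A : Type*) where
  | dir (a : A) : Syllable A
  | inv (a : A) : Syllable A

namespace Syllable

/-- The formal inverse of a syllable. -/
def flip {A : Type*} : Syllable A → Syllable A
  | dir a => inv a
  | inv a => dir a

/-- The syllable is an arrow. -/
def IsDirect {A : Type*} : Syllable A → Prop
  | dir _ => True
  | inv _ => False

/-- The syllable is the inverse of an arrow. -/
def IsInverse {A : Type*} : Syllable A → Prop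
  | dir _ => False
  | inv _ => True

theorem flip_injective {A : Type*} : Function.Injective (flip (A := A)) := by
  intro x y h
  cases x <;> cases y <;> simp_all [flip]

end Syllable

/-- The combinatorial presentation `(Q, ρ, σ, ε)` of a string algebra `KQ/⟨ρ⟩` with vertices `V`
and arrows `A`, together with a fixed bisection `(σ, ε)` (signs are elements of `ℤˣ = {1, -1}`).
Paths are listed in the order of travel: `a_n ⋯ a_2 a_1` is the list `[a_1, a_2, …, a_n]`.
Since `ρ` consists of monomials, a path lies in the ideal `⟨ρ⟩` if and only if one of its
subpaths lies in `ρ`; that `⟨ρ⟩` is admissible then means that the paths in `ρ` have length at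
least `2` and that all sufficiently long paths lie in `⟨ρ⟩`. -/
structure StringAlgebra (V A : Type*) where
  src : A → V
  tgt : A → V
  ρ : Set (List A)
  outdegree_le : ∀ v, {a | src a = v}.encard ≤ 2
  indegree_le : ∀ v, {a | tgt a = v}.encard ≤ 2
  ρ_isPath : ∀ p ∈ ρ, p.IsChain (fun a b => tgt a = src b)
  ρ_length : ∀ p ∈ ρ, 2 ≤ p.length
  admissible : ∃ N : ℕ, ∀ p : List A, p.IsChain (fun a b => tgt a = src b) →
    N ≤ p.length → ∃ q ∈ ρ, q <:+: p
  ρ_minimal : ∀ p ∈ ρ, ∀ q ∈ ρ, q <:+: p → q = p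
  unique_after : ∀ a b b', src b = tgt a → src b' = tgt a →
    (¬ ∃ q ∈ ρ, q <:+: [a, b]) → (¬ ∃ q ∈ ρ, q <:+: [a, b']) → b = b'
  unique_before : ∀ a b b', tgt b = src a → tgt b' = src a →
    (¬ ∃ q ∈ ρ, q <:+: [b, a]) → (¬ ∃ q ∈ ρ, q <:+: [b', a]) → b = b'
  σ : A → ℤˣ
  ε : A → ℤˣ
  σ_ne : ∀ a b, a ≠ b → src a = src b → σ a = -σ b
  ε_ne : ∀ a b, a ≠ b → tgt a = tgt b → ε a = -ε b
  σ_eq_neg_ε : ∀ a b, tgt a = src b → (¬ ∃ q ∈ ρ, q <:+: [a, b]) → σ b = -ε a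

/-! ### Words -/

/-- Words (composability of consecutive syllables is imposed in `StringAlgebra.IsString`).
`one v i` is the zero-length word `1_(v,i)`. A word `α_n ⋯ α_2 α_1` of positive length is
`path [α_1, α_2, …, α_n] _`, i.e. syllables are listed from right to left. -/
inductive Word (V A : Type*) where
  | one (v : V) (i : ℤˣ) : Word V A
  | path (l : List (Syllable A)) (h : l ≠ []) : Word V A

namespace Word

variable {V A : Type*}

/-- The syllables of a word, from right to left. -/
def toList : Word V A → List (Syllable A)
  | one _ _ => []
  | path l _ => l

/-- The inverse of a word. -/
def inv : Word V A → Word V A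
  | one v i => one v (-i)
  | path l h => path (l.reverse.map Syllable.flip) (by simpa using h)

/-- The concatenation `u x` of words; meaningful when `u` and `x` are composable. -/
def comp : Word V A → Word V A → Word V A
  | one _ _, x => x
  | path l h, one _ _ => path l h
  | path l _, path m hm => path (m ++ l) (by simp [hm])

/-- Two words of positive length that are cyclic permutations of each other. -/
def IsCyclicPerm (x y : Word V A) : Prop :=
  x.toList ≠ [] ∧ x.toList ~r y.toList

theorem inv_injective : Function.Injective (inv (V := V) (A := A)) := by
  intro x y h
  cases x <;> cases y <;> simp_all [inv]
  exact Syllable.flip_injective.list_map h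

end Word

/-! ### Finite and infinite strings, and their orders -/

/-- Finite words, and left infinite sequences `⋯ α_3 α_2 α_1` (the stream `α_1, α_2, …`). -/
inductive LeftExt (V A : Type*) where
  | fin (w : Word V A) : LeftExt V A
  | inf (s : Stream' (Syllable A)) : LeftExt V A

/-- Finite words, and right infinite sequences `α_1 α_2 α_3 ⋯` (the stream `α_1, α_2, …`). -/
inductive RightExt (V A : Type*) where
  | fin (w : Word V A) : RightExt V A
  | inf (s : Stream' (Syllable A)) : RightExt V A

namespace LeftExt

variable {V A : Type*}

/-- The `(k+1)`-st syllable from the right, or `none` if there is no such syllable. -/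
def syl : LeftExt V A → ℕ → Option (Syllable A)
  | fin w, k => w.toList[k]?
  | inf s, k => some (s.get k)

/-- Continuing by a direct syllable is smaller than stopping, which is smaller than continuing by
an inverse syllable. -/
def rank : Option (Syllable A) → ℤ
  | some (Syllable.dir _) => -1
  | none => 0
  | some (Syllable.inv _) => 1

/-- The relation `x <_l y`: after the maximal common left substring `w` of `x` and `y`, either
`x = w` and `y` continues by an inverse syllable, or `y = w` and `x` continues by a direct
syllable, or `x` continues by a direct and `y` by an inverse syllable. -/
def SLt (x y : LeftExt V A) : Prop :=
  ∃ k, (∀ j < k, x.syl j = y.syl j) ∧ rank (x.syl k) < rank (y.syl k)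

theorem SLt.irrefl (x : LeftExt V A) : ¬ SLt x x := by
  rintro ⟨k, _, h⟩
  exact lt_irrefl _ h

theorem SLt.trans {x y z : LeftExt V A} (h₁ : SLt x y) (h₂ : SLt y z) : SLt x z := by
  obtain ⟨k, hk, hk'⟩ := h₁
  obtain ⟨m, hm, hm'⟩ := h₂
  rcases lt_trichotomy k m with h | h | h
  · exact ⟨k, fun j hj => (hk j hj).trans (hm j (hj.trans h)), by rwa [← hm k h]⟩
  · subst h
    exact ⟨k, fun j hj => (hk j hj).trans (hm j hj), hk'.trans hm'⟩
  · exact ⟨m, fun j hj => (hk j (hj.trans h)).trans (hm j hj), by rwa [hk m h]⟩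

/-- The order `≤_l`. -/
instance : PartialOrder (LeftExt V A) where
  le x y := x = y ∨ SLt x y
  le_refl x := Or.inl rfl
  le_trans x y z := by
    rintro (rfl | h₁) (rfl | h₂)
    · exact Or.inl rfl
    · exact Or.inr h₂
    · exact Or.inr h₁
    · exact Or.inr (h₁.trans h₂)
  le_antisymm x y := by
    rintro (rfl | h₁) (h | h₂)
    · rfl
    · rfl
    · exact h.symm
    · exact absurd (h₁.trans h₂) (SLt.irrefl x)

/-- The left infinite sequence `^∞b x` (with the convention `^∞1_(v,i) x = x`). -/
def powComp : Word V A → Word V A → LeftExt V A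
  | Word.one _ _, x => fin x
  | Word.path l h, x => inf (x.toList ++ₛ Stream'.cycle l h)

/-- The left infinite power `^∞b = ⋯ b b b` (with the convention `^∞1_(v,i) = 1_(v,i)`). -/
def pow : Word V A → LeftExt V A
  | Word.one v i => fin (Word.one v i)
  | Word.path l h => inf (Stream'.cycle l h)

end LeftExt

namespace RightExt

variable {V A : Type*}

/-- The inverse of a finite or right infinite word is a finite or left infinite word. -/
def inv : RightExt V A → LeftExt V A
  | fin w => LeftExt.fin w.inv
  | inf s => LeftExt.inf (s.map Syllable.flip)

theorem inv_injective : Function.Injective (inv (V := V) (A := A)) := by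
  intro x y h
  cases x with
  | fin w =>
    cases y with
    | fin w' =>
      simp only [inv, LeftExt.fin.injEq] at h
      rw [Word.inv_injective h]
    | inf s => simp [inv] at h
  | inf s =>
    cases y with
    | fin w' => simp [inv] at h
    | inf s' =>
      simp only [inv, LeftExt.inf.injEq] at h
      congr 1
      ext n
      apply Syllable.flip_injective
      have := congrArg (fun t => Stream'.get t n) h
      simpa using this

/-- The order `≤_r`: `x ≤_r y` if and only if `x⁻¹ ≤_l y⁻¹`. -/
instance : PartialOrder (RightExt V A) := PartialOrder.lift inv inv_injective

/-- The right infinite power `b^∞ = b b b ⋯` (with the convention `1_(v,i)^∞ = 1_(v,i)`). -/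
def pow : Word V A → RightExt V A
  | Word.one v i => fin (Word.one v i)
  | Word.path l h => inf (Stream'.cycle l.reverse (by simpa using h))

end RightExt

/-! ### Order-theoretic notions -/

/-- A subset of a poset is scattered if the order `ℚ` does not embed into it. -/
def IsScattered {P : Type*} [PartialOrder P] (X : Set P) : Prop :=
  IsEmpty (ℚ ↪o X)

/-- `I` is an interval (a convex subset) of `L`. -/
def IsIntervalIn {P : Type*} [PartialOrder P] (L I : Set P) : Prop :=
  I ⊆ L ∧ ∀ x ∈ I, ∀ y ∈ I, ∀ z ∈ L, x ≤ z → z ≤ y → z ∈ I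

/-- For an interval `I` of `L ⊆ M`, the set of all `z ∈ M` for which some `z' ∈ I` satisfies
`[z, z'] ∪ [z', z] ⊆ I`, where intervals are formed in `L`. -/
def intervalClosure {P : Type*} [PartialOrder P] (M L I : Set P) : Set P :=
  {z | z ∈ M ∧ ∃ z' ∈ I, {y | y ∈ L ∧ z ≤ y ∧ y ≤ z'} ∪ {y | y ∈ L ∧ z' ≤ y ∧ y ≤ z} ⊆ I}

/-! ### Strings, bands and hammocks of a string algebra -/

namespace StringAlgebra

variable {V A : Type*} (Λ : StringAlgebra V A)

/-- Source of a syllable. -/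
def sylSrc : Syllable A → V
  | .dir a => Λ.src a
  | .inv a => Λ.tgt a

/-- Target of a syllable. -/
def sylTgt : Syllable A → V
  | .dir a => Λ.tgt a
  | .inv a => Λ.src a

/-- The sign `σ` of a syllable. -/
def sylσ : Syllable A → ℤˣ
  | .dir a => Λ.σ a
  | .inv a => Λ.ε a

/-- The sign `ε` of a syllable. -/
def sylε : Syllable A → ℤˣ
  | .dir a => Λ.ε a
  | .inv a => Λ.σ a

/-- Source of a word. -/
def s : Word V A → V
  | .one v _ => v
  | .path l h => Λ.sylSrc (l.head h)

/-- Target of a word. -/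
def t : Word V A → V
  | .one v _ => v
  | .path l h => Λ.sylTgt (l.getLast h)

/-- The sign `σ` of a word. -/
def wordσ : Word V A → ℤˣ
  | .one _ i => -i
  | .path l h => Λ.sylσ (l.head h)

/-- The sign `ε` of a word. -/
def wordε : Word V A → ℤˣ
  | .one _ i => i
  | .path l h => Λ.sylε (l.getLast h)

/-- The conditions for a list of syllables (from right to left) to be a string: consecutive
syllables are composable and not inverse to each other, and there is no subpath in `ρ ∪ ρ⁻¹`. -/
def IsStringList (l : List (Syllable A)) : Prop :=
  l.IsChain (fun α β => Λ.sylTgt α = Λ.sylSrc β) ∧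
  l.IsChain (fun α β => β ≠ α.flip) ∧
  ∀ p ∈ Λ.ρ, ¬ p.map Syllable.dir <:+: l ∧ ¬ (p.map Syllable.inv).reverse <:+: l

/-- Strings. -/
def IsString (x : Word V A) : Prop := Λ.IsStringList x.toList

/-- The composition `u x` is defined. If `u = 1_(v,i)` this says `t(x) = v` and `ε(x) = i`; if
`x = 1_(v,i)` it says `s(u) = v` and `i = -σ(u)`. -/
def Composable (u x : Word V A) : Prop :=
  Λ.s u = Λ.t x ∧ (u.toList = [] ∨ x.toList = [] → Λ.wordσ u = -Λ.wordε x)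

/-- `u x` is (defined and) a string. -/
def IsString₂ (u x : Word V A) : Prop :=
  Λ.Composable u x ∧ Λ.IsString (u.comp x)

/-- `y u x` is (defined and) a string. -/
def IsString₃ (y u x : Word V A) : Prop :=
  Λ.Composable u x ∧ Λ.IsString₂ y (u.comp x)

/-- Bands: strings `b = α_n ⋯ α_1` with `α_n` direct, `α_1` inverse, such that `b²` is a string
and `b` is not a proper power of a string. -/
def IsBand (b : Word V A) : Prop :=
  Λ.IsString b ∧
  (∃ h : b.toList ≠ [], (b.toList.getLast h).IsDirect ∧ (b.toList.head h).IsInverse) ∧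
  Λ.IsString₂ b b ∧
  ¬ ∃ (x : Word V A) (n : ℕ), Λ.IsString x ∧ 2 ≤ n ∧
    b.toList = (List.replicate n x.toList).flatten

/-- `Q₀` is a set of representatives of the bands up to cyclic permutation. -/
def IsBandTransversal (Q₀ : Set (Word V A)) : Prop :=
  (∀ b ∈ Q₀, Λ.IsBand b) ∧ ∀ b, Λ.IsBand b → ∃! b', b' ∈ Q₀ ∧ b.IsCyclicPerm b'

/-- The cycles: cyclic permutations of elements of `Q₀`. -/
def Cyc (Q₀ : Set (Word V A)) : Set (Word V A) :=
  {b₁ | ∃ b ∈ Q₀, b₁.IsCyclicPerm b}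

/-- The relation `b₁ ⪯ b₂` on bands: `b₂ u b₁` is a string for some string `u`. -/
def Reaches (b₁ b₂ : Word V A) : Prop :=
  ∃ u, Λ.IsString u ∧ Λ.IsString₃ b₂ u b₁

/-- The set of equivalence classes of `Q₀` under `≈ := ⪯ ∩ ⪰`. -/
def QBa (Q₀ : Set (Word V A)) : Set (Set (Word V A)) :=
  {B | ∃ b ∈ Q₀, B = {b' | b' ∈ Q₀ ∧ Λ.Reaches b b' ∧ Λ.Reaches b' b}}

/-- The set `Ba_l(B)`. -/
def Bal (B : Set (Word V A)) : Set (Word V A) :=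
  {b | b ∈ B ∧ ∀ b₁ ∈ B, ∀ u, Λ.IsString u → Λ.IsString₃ b₁ u b →
    LeftExt.pow b ≤ LeftExt.powComp b₁ (u.comp b)}

/-- The set `Ba_l̄(B)`. -/
def BalBar (B : Set (Word V A)) : Set (Word V A) :=
  {b | b ∈ B ∧ ∀ b₁ ∈ B, ∀ u, Λ.IsString u → Λ.IsString₃ b₁ u b →
    LeftExt.powComp b₁ (u.comp b) ≤ LeftExt.pow b}

/-- The left `ℕ`-strings. -/
def leftNStrings : Set (LeftExt V A) :=
  {x | ∃ f, x = .inf f ∧ ∀ n, Λ.IsStringList (f.take n)}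

/-- The right `ℕ`-strings. -/
def rightNStrings : Set (RightExt V A) :=
  {x | ∃ f, x = .inf f ∧ ∀ n, Λ.IsStringList (f.take n).reverse}

/-- The left hammock `H_l(x₀)`: strings `u x₀`. -/
def Hl (x₀ : Word V A) : Set (LeftExt V A) :=
  {x | ∃ w, x = .fin w ∧ Λ.IsString w ∧
    ∃ u, Λ.IsString u ∧ Λ.Composable u x₀ ∧ w = u.comp x₀}

/-- The right hammock `H_r(x₀)`: strings `x₀ u`. -/
def Hr (x₀ : Word V A) : Set (RightExt V A) :=
  {x | ∃ w, x = .fin w ∧ Λ.IsString w ∧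
    ∃ u, Λ.IsString u ∧ Λ.Composable x₀ u ∧ w = x₀.comp u}

/-- The left infinite sequence contains `x₀` as a left substring. -/
def LeftContains : Word V A → Stream' (Syllable A) → Prop
  | .one v i, f => Λ.sylSrc f.head = v ∧ i = -Λ.sylσ f.head
  | .path l _, f => ∃ g, f = l ++ₛ g

/-- The right infinite sequence contains `x₀` as a right substring. -/
def RightContains : Word V A → Stream' (Syllable A) → Prop
  | .one v i, f => Λ.sylTgt f.head = v ∧ Λ.sylε f.head = i
  | .path l _, f => ∃ g, f = l.reverse ++ₛ g

/-- The completion of `H_l(x₀)`. -/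
def HlHat (x₀ : Word V A) : Set (LeftExt V A) :=
  Λ.Hl x₀ ∪ {x | x ∈ Λ.leftNStrings ∧ ∃ f, x = .inf f ∧ Λ.LeftContains x₀ f}

/-- The completion of `H_r(x₀)`. -/
def HrHat (x₀ : Word V A) : Set (RightExt V A) :=
  Λ.Hr x₀ ∪ {x | x ∈ Λ.rightNStrings ∧ ∃ f, x = .inf f ∧ Λ.RightContains x₀ f}

/-- The hammock poset `H(v)`, with the product order of `≤_l` and `≤_r`. -/
def H (v : V) : Set (LeftExt V A × RightExt V A) :=
  {p | ∃ u w : Word V A, p = (.fin u, .fin w) ∧ Λ.IsString u ∧ Λ.IsString w ∧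
    Λ.s u = v ∧ v = Λ.t w ∧ Λ.wordε w = 1 ∧ 1 = -Λ.wordσ u ∧ Λ.IsString₂ u w}

/-- The pair `(^∞b, b^∞)`. -/
def point (b : Word V A) : LeftExt V A × RightExt V A :=
  (LeftExt.pow b, RightExt.pow b)

/-- The extended hammock poset `H̄(v)`. -/
def HBar (Q₀ : Set (Word V A)) (v : V) : Set (LeftExt V A × RightExt V A) :=
  Λ.H v ∪ {p | p ∈ Λ.leftNStrings ×ˢ Λ.rightNStrings ∧ ∃ b ∈ Cyc Q₀, p = point b ∧
    Λ.wordε b = 1 ∧ 1 = -Λ.wordσ b ∧ Λ.s b = v ∧ v = Λ.t b}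

/-- `X` is a box in `H(v)`. -/
def IsBox (v : V) (X : Set (LeftExt V A × RightExt V A)) : Prop :=
  X ⊆ Λ.H v ∧
  IsIntervalIn (Λ.Hl (.one v 1)) (Prod.fst '' X) ∧
  IsIntervalIn (Λ.Hr (.one v 1)) (Prod.snd '' X) ∧
  X = Λ.H v ∩ (Prod.fst '' X) ×ˢ (Prod.snd '' X)

/-- The closure of a box of `H(v)` in `H̄(v)`. -/
def boxClosure (Q₀ : Set (Word V A)) (v : V) (X : Set (LeftExt V A × RightExt V A)) :
    Set (LeftExt V A × RightExt V A) :=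
  X ∪ {p | p ∈ Λ.HBar Q₀ v ∧ (∃ b ∈ Cyc Q₀, p = point b) ∧
    p.1 ∈ intervalClosure (Λ.HlHat (.one v 1)) (Λ.Hl (.one v 1)) (Prod.fst '' X) ∧
    p.2 ∈ intervalClosure (Λ.HrHat (.one v 1)) (Λ.Hr (.one v 1)) (Prod.snd '' X)}

/-- A point of `H̄(v)` is exceptional if it has the form `(^∞b, b^∞)` and lies in the closure of
a scattered box of `H(v)`. -/
def IsExceptional (Q₀ : Set (Word V A)) (v : V) (p : LeftExt V A × RightExt V A) : Prop :=
  p ∈ Λ.HBar Q₀ v ∧ (∃ b ∈ Cyc Q₀, p = point b) ∧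
    ∃ X, Λ.IsBox v X ∧ IsScattered X ∧ p ∈ Λ.boxClosure Q₀ v X

/-- The set `Cyc(v)` of cycles `b` with `(^∞b, b^∞) ∈ H̄(v)`. -/
def CycAt (Q₀ : Set (Word V A)) (v : V) : Set (Word V A) :=
  {b | b ∈ Cyc Q₀ ∧ point b ∈ Λ.HBar Q₀ v}

end StringAlgebra

/-!
The order `<_l` refines the tree of strings: at each node, continuing by a direct syllable lies
below stopping, and stopping lies below continuing by an inverse syllable. Since relations consist
of paths, strings may be glued at every peak, that is, where a direct syllable is followed (in the
order of travel, from right to left in the usual notation) by an inverse one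
(`IsStringList.append`). A band begins with an inverse and ends with a direct syllable, so
everything that begins and ends like a given band can be concatenated freely.

*Finiteness.* Two bands with the same last syllable can therefore be composed in both orders. They
are equivalent, and if both are minimal (or both maximal) in the sense of `Bal` (`BalBar`), then
each of their left infinite powers bounds the other. So these powers agree, and the two bands agree,
because a primitive word is determined by the periodic sequence that it generates
(`Stream'.eq_of_cycle_eq`). Hence an extremal band is determined by its last syllable, up to the
choice between the two sides.

*Exceptional points come from extremal bands.* Let `b` be a band that is neither minimal nor
maximal. Then some loop at `b` branches off from `^∞b` downwards, and another one upwards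
(`exists_branch_lt_of_not_mem_Bal`, `exists_branch_gt_of_not_mem_BalBar`). Let `b₁` be a rotation
of `b` whose point lies in the closure of a box. On the right, some finite truncation `w` of
`b₁^∞` belongs to the box (`exists_take_mem_of_mem_intervalClosure`). On the left, the box contains
all strings between `^∞b₁` and some `z ≠ ^∞b₁`; the loop that branches off to the side of `z`,
inserted after many copies of `b`, leads to strings in this interval. This loop and a power of `b`
leave each other after a common part `c`, one by a direct and the other by an inverse syllable.
The products of the two, each followed by `c`, are thus ordered like the nodes of the infinite
binary tree in in-order, and this order is dense (`not_isScattered_of_binary_tree`,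
`not_isScattered_of_isLoop`). Paired with `w`, they show that the box is not scattered.

The finiteness of the set of exceptional points follows, as a band has finitely many rotations.
-/

/-! ### Binary trees and scattered sets -/

/-- The four relative positions of two nodes of the infinite binary tree. -/
theorem List.bool_positions (w w' : List Bool) :
    w = w' ∨ (∃ (a : Bool) (x : List Bool), w' = w ++ a :: x) ∨
      (∃ (a : Bool) (x : List Bool), w = w' ++ a :: x) ∨
      ∃ (d : List Bool) (a : Bool) (x y : List Bool), w = d ++ a :: x ∧ w' = d ++ (!a) :: y := by
  induction w generalizing w' with
  | nil => cases w' with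
    | nil => exact Or.inl rfl
    | cons a x => exact Or.inr (Or.inl ⟨a, x, rfl⟩)
  | cons a x ih => cases w' with
    | nil => exact Or.inr (Or.inr (Or.inl ⟨a, x, rfl⟩))
    | cons b y =>
      by_cases hab : b = a
      · subst hab
        rcases ih y with rfl | ⟨c, z, rfl⟩ | ⟨c, z, rfl⟩ | ⟨d, c, z, z', rfl, rfl⟩
        · exact Or.inl rfl
        · exact Or.inr (Or.inl ⟨c, z, rfl⟩)
        · exact Or.inr (Or.inr (Or.inl ⟨c, z, rfl⟩))
        · exact Or.inr (Or.inr (Or.inr ⟨b :: d, c, z, z', rfl, rfl⟩))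
      · obtain rfl : b = !a := by cases a <;> cases b <;> simp_all
        exact Or.inr (Or.inr (Or.inr ⟨[], a, x, y, rfl, rfl⟩))

/-- A set that contains the nodes of an infinite binary tree, each node lying above its left
subtree and below its right subtree, is not scattered: the in-order of the tree is dense. -/
theorem not_isScattered_of_binary_tree {P : Type*} [PartialOrder P] {X : Set P}
    (f : List Bool → P) (hX : ∀ w, f w ∈ X) (h0 : ∀ w x : List Bool, f (w ++ false :: x) < f w)
    (h1 : ∀ w x : List Bool, f w < f (w ++ true :: x)) : ¬ IsScattered X := by
  have total : ∀ w w', f w ≤ f w' ∨ f w' ≤ f w := by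
    intro w w'
    rcases List.bool_positions w w' with
      rfl | ⟨a, x, rfl⟩ | ⟨a, x, rfl⟩ | ⟨d, a, x, y, rfl, rfl⟩
    · exact Or.inl le_rfl
    · cases a
      · exact Or.inr (h0 _ _).le
      · exact Or.inl (h1 _ _).le
    · cases a
      · exact Or.inl (h0 _ _).le
      · exact Or.inr (h1 _ _).le
    · cases a
      · exact Or.inl ((h0 _ _).trans (h1 _ _)).le
      · exact Or.inr ((h0 _ _).trans (h1 _ _)).le
  have dense : ∀ w w', f w < f w' → ∃ w'', f w < f w'' ∧ f w'' < f w' := by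
    intro w w' h
    rcases List.bool_positions w w' with
      rfl | ⟨a, x, rfl⟩ | ⟨a, x, rfl⟩ | ⟨d, a, x, y, rfl, rfl⟩
    · exact absurd h (lt_irrefl _)
    · cases a
      · exact absurd h (h0 _ _).asymm
      · refine ⟨w ++ true :: (x ++ [false]), h1 _ _, ?_⟩
        simpa using h0 (w ++ true :: x) []
    · cases a
      · refine ⟨w' ++ false :: (x ++ [true]), ?_, h0 _ _⟩
        simpa using h1 (w' ++ false :: x) []
      · exact absurd h (h1 _ _).asymm
    · cases a
      · exact ⟨d, h0 _ _, h1 _ _⟩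
      · exact absurd h ((h0 _ _).trans (h1 _ _)).asymm
  let _ : LinearOrder (Set.range f) :=
    { (inferInstance : PartialOrder (Set.range f)) with
      le_total := by
        rintro ⟨_, w, rfl⟩ ⟨_, w', rfl⟩
        exact total w w'
      toDecidableLE := Classical.decRel _ }
  have : DenselyOrdered (Set.range f) := ⟨by
    rintro ⟨_, w, rfl⟩ ⟨_, w', rfl⟩ h
    obtain ⟨w'', h', h''⟩ := dense w w' h
    exact ⟨⟨_, w'', rfl⟩, h', h''⟩⟩
  have : Nontrivial (Set.range f) :=
    ⟨⟨_, [], rfl⟩, ⟨_, [true], rfl⟩, fun h => (h1 [] []).ne (congrArg Subtype.val h)⟩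
  obtain ⟨e⟩ := Order.embedding_from_countable_to_dense (α := ℚ) (β := Set.range f)
  intro hs
  have hsub : ∀ q, (e q : P) ∈ X := by
    intro q
    obtain ⟨w, hw⟩ := (e q).2
    exact hw ▸ hX w
  exact hs.false ⟨⟨fun q => ⟨e q, hsub q⟩, fun _ _ h =>
    e.injective (Subtype.ext (congrArg (fun z : X => (z : P)) h))⟩, fun {_ _} => e.le_iff_le⟩

/-! ### Periodic streams -/

theorem Function.Periodic.gcd {α : Type*} {f : ℕ → α} {p q : ℕ} (hp : Function.Periodic f p)
    (hq : Function.Periodic f q) : Function.Periodic f (Nat.gcd p q) := by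
  induction p, q using Nat.gcd.induction with
  | H0 n => simpa using hq
  | H1 m n _ ih =>
    rw [Nat.gcd_rec]
    refine ih (fun k => ?_) hp
    have h := hp.nat_mul (n / m) (k + n % m)
    simp only [Nat.cast_id] at h
    rw [← h, add_assoc, mul_comm, Nat.mod_add_div, hq]

namespace Stream'

variable {α : Type*}

theorem eq_cycle_of_eq_append {l : List α} (h : l ≠ []) {f : Stream' α} (hf : f = l ++ₛ f) :
    f = cycle l h := by
  ext n
  induction n using Nat.strong_induction_on with
  | _ n ih =>
    rw [hf, cycle_eq l h]
    rcases lt_or_ge n l.length with hn | hn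
    · rw [get_append_left _ _ _ hn, get_append_left _ _ _ hn]
    · obtain ⟨k, rfl⟩ := Nat.exists_eq_add_of_le hn
      rw [get_append_right, get_append_right]
      exact ih k (by have := List.length_pos_of_ne_nil h; omega)

theorem cycle_eq_replicate_append {l : List α} (h : l ≠ []) (n : ℕ) :
    cycle l h = (List.replicate n l).flatten ++ₛ cycle l h := by
  induction n with
  | zero => simp
  | succ n ih =>
    rw [List.replicate_succ, List.flatten_cons, append_append_stream, ← ih, ← cycle_eq]

theorem cycle_append_comm {s t : List α} (h : s ++ t ≠ []) (h' : t ++ s ≠ []) :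
    cycle (t ++ s) h' = t ++ₛ cycle (s ++ t) h := by
  refine (eq_cycle_of_eq_append h' ?_).symm
  conv_lhs => rw [cycle_eq (s ++ t) h]
  simp

theorem periodic_get_cycle {l : List α} (h : l ≠ []) :
    Function.Periodic (cycle l h).get l.length := by
  intro n
  conv_lhs => rw [cycle_eq l h, add_comm, get_append_right]

/-- A list that is not a proper power of one of its prefixes is determined by the periodic stream
that it generates: the greatest common divisor of two periods of a stream is again a period. -/
theorem eq_of_cycle_eq {l m : List α} (hl : l ≠ []) (hm : m ≠ []) (h : cycle l hl = cycle m hm)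
    (hlp : ∀ x n, x <+: l → 2 ≤ n → l ≠ (List.replicate n x).flatten)
    (hmp : ∀ x n, x <+: m → 2 ≤ n → m ≠ (List.replicate n x).flatten) : l = m := by
  -- A period that divides the length of `l` is not a proper divisor, as `l` is primitive.
  have key : ∀ (l : List α) (hl : l ≠ []) (g : ℕ), 0 < g → g ∣ l.length →
      Function.Periodic (cycle l hl).get g →
      (∀ x n, x <+: l → 2 ≤ n → l ≠ (List.replicate n x).flatten) → l.length = g := by
    rintro l hl g hg ⟨n, hn⟩ hper hp
    by_contra hne
    have hn2 : 2 ≤ n := by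
      rcases n with _ | _ | n
      · simp at hn; exact absurd hn hl
      · simp at hn; exact absurd hn hne
      · omega
    have hgl : g ≤ l.length := by rw [hn]; exact Nat.le_mul_of_pos_right _ (by omega)
    have htake : (cycle l hl).take g = l.take g := by
      conv_lhs => rw [cycle_eq l hl]
      exact take_append_of_le_length _ _ _ hgl
    have hxne : l.take g ≠ [] := by
      simp [hl]; omega
    have hcyc : cycle l hl = cycle (l.take g) hxne := by
      apply eq_cycle_of_eq_append
      rw [← htake]
      conv_lhs => rw [← append_take_drop g (cycle l hl)]
      congr 1
      ext k
      rw [get_drop, add_comm, hper]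
    refine hp (l.take g) n (List.take_prefix _ _) hn2 ?_
    have h2 := cycle_eq_replicate_append hxne n
    rw [← hcyc] at h2
    conv_lhs at h2 => rw [cycle_eq l hl]
    refine append_left_injective _ _ _ _ h2 ?_
    rw [List.length_flatten, List.map_replicate, List.sum_replicate, List.length_take,
      min_eq_left hgl, hn, smul_eq_mul, mul_comm]
  have hper : Function.Periodic (cycle l hl).get (Nat.gcd l.length m.length) :=
    (periodic_get_cycle hl).gcd (h ▸ periodic_get_cycle hm)
  have hpos : 0 < Nat.gcd l.length m.length :=
    Nat.gcd_pos_of_pos_left _ (List.length_pos_of_ne_nil hl)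
  have h1 := key l hl _ hpos (Nat.gcd_dvd_left _ _) hper hlp
  have h2 := key m hm _ hpos (Nat.gcd_dvd_right _ _) (h ▸ hper) hmp
  rw [cycle_eq l hl, cycle_eq m hm] at h
  exact append_left_injective _ _ _ _ h (h1.trans h2.symm)

end Stream'

/-! ### Words and the order on them -/

namespace Syllable

variable {A : Type*}

@[simp] theorem flip_flip (α : Syllable A) : α.flip.flip = α := by cases α <;> rfl

instance [Finite A] : Finite (Syllable A) := by
  refine Finite.of_injective (β := A ⊕ A)
    (fun | dir a => Sum.inl a | inv a => Sum.inr a) ?_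
  rintro (a | a) (b | b) h <;> simp_all

end Syllable

theorem Word.toList_comp {V A : Type*} (u x : Word V A) :
    (u.comp x).toList = x.toList ++ u.toList := by
  cases u <;> cases x <;> simp [Word.comp, Word.toList]

theorem Word.eq_path_of_toList_ne_nil {V A : Type*} {x : Word V A} (h : x.toList ≠ []) :
    x = .path x.toList h := by
  cases x
  · exact absurd rfl h
  · rfl

namespace LeftExt

variable {V A : Type*}

@[simp] theorem syl_fin (w : Word V A) (k : ℕ) : (fin w).syl k = w.toList[k]? := rfl

@[simp] theorem syl_inf (f : Stream' (Syllable A)) (k : ℕ) :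
    (inf f : LeftExt V A).syl k = some (f.get k) := rfl

theorem SLt.lt {x y : LeftExt V A} (h : SLt x y) : x < y := by
  refine lt_of_le_of_ne (Or.inr h) ?_
  rintro rfl
  exact SLt.irrefl _ h

/-- The order is decided by the first difference. -/
theorem SLt.of_agree_left {x y x' : LeftExt V A} {k : ℕ} (hk : ∀ j < k, x.syl j = y.syl j)
    (hr : rank (x.syl k) < rank (y.syl k)) (h : ∀ j ≤ k, x'.syl j = x.syl j) : SLt x' y :=
  ⟨k, fun j hj => (h j hj.le).trans (hk j hj), by rwa [h k le_rfl]⟩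

theorem SLt.of_agree_right {x y y' : LeftExt V A} {k : ℕ} (hk : ∀ j < k, x.syl j = y.syl j)
    (hr : rank (x.syl k) < rank (y.syl k)) (h : ∀ j ≤ k, y'.syl j = y.syl j) : SLt x y' :=
  ⟨k, fun j hj => (hk j hj).trans (h j hj.le).symm, by rwa [h k le_rfl]⟩

theorem syl_fin_append {w : Word V A} {q r : List (Syllable A)} (h : w.toList = q ++ r)
    (f : Stream' (Syllable A)) {j : ℕ} (hj : j < q.length) :
    (fin w).syl j = (inf (q ++ₛ f) : LeftExt V A).syl j := by
  rw [syl_fin, syl_inf, h, List.getElem?_append_left hj, Stream'.get_append_left _ _ _ hj,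
    List.getElem?_eq_getElem hj]

theorem syl_fin_append_cons {w : Word V A} {q r : List (Syllable A)} {α : Syllable A}
    (h : w.toList = q ++ α :: r) : (fin w).syl q.length = some α := by
  rw [syl_fin, h, List.getElem?_append_right le_rfl]
  simp

theorem lt_of_direct {u u' : Word V A} {q r : List (Syllable A)} {α : Syllable A}
    (hα : rank (some α) < 0) (h : u.toList = q ++ α :: r) (h' : u'.toList = q) :
    fin u < fin u' := by
  refine SLt.lt ⟨q.length, fun j hj => ?_, ?_⟩
  · rw [syl_fin, syl_fin, h, h', List.getElem?_append_left hj]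
  · rw [syl_fin_append_cons h, syl_fin, h', List.getElem?_eq_none le_rfl]
    exact hα

theorem lt_of_inverse {u u' : Word V A} {q r : List (Syllable A)} {α : Syllable A}
    (hα : 0 < rank (some α)) (h : u.toList = q ++ α :: r) (h' : u'.toList = q) :
    fin u' < fin u := by
  refine SLt.lt ⟨q.length, fun j hj => ?_, ?_⟩
  · rw [syl_fin, syl_fin, h, h', List.getElem?_append_left hj]
  · rw [syl_fin_append_cons h, syl_fin, h', List.getElem?_eq_none le_rfl]
    exact hα

theorem rank_some_lt {α β : Syllable A} (h : rank (some α) < rank (some β)) :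
    rank (some α) < 0 ∧ 0 < rank (some β) := by
  cases α <;> cases β <;> simp_all [rank]

theorem syl_succ_isSome {x : LeftExt V A} {k : ℕ} {α : Syllable A} (h : x.syl (k + 1) = some α) :
    ∃ β, x.syl k = some β := by
  cases x with
  | inf f => exact ⟨_, rfl⟩
  | fin w =>
    rw [syl_fin] at h
    obtain ⟨hk, -⟩ := List.getElem?_eq_some_iff.1 h
    exact ⟨_, List.getElem?_eq_getElem (by omega)⟩

theorem inf_append_le_iff {q : List (Syllable A)} {f g : Stream' (Syllable A)} :
    (inf (q ++ₛ f) : LeftExt V A) ≤ inf (q ++ₛ g) ↔ (inf f : LeftExt V A) ≤ inf g := by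
  constructor
  · rintro (h | ⟨k, hk, hr⟩)
    · exact Or.inl (by simpa using h)
    · right
      rcases lt_or_ge k q.length with h | h
      · rw [syl_inf, syl_inf, Stream'.get_append_left _ _ _ h,
          Stream'.get_append_left _ _ _ h] at hr
        exact absurd hr (lt_irrefl _)
      · obtain ⟨m, rfl⟩ := Nat.exists_eq_add_of_le h
        refine ⟨m, fun j hj => ?_, ?_⟩
        · have := hk (q.length + j) (by omega)
          simpa using this
        · simpa using hr
  · rintro (h | ⟨k, hk, hr⟩)
    · exact Or.inl (by simpa using h)
    · refine Or.inr ⟨q.length + k, fun j hj => ?_, ?_⟩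
      · rcases lt_or_ge j q.length with h | h
        · rw [syl_inf, syl_inf, Stream'.get_append_left _ _ _ h, Stream'.get_append_left _ _ _ h]
        · obtain ⟨m, rfl⟩ := Nat.exists_eq_add_of_le h
          have := hk m (by omega)
          simpa using this
      · simpa using hr

end LeftExt

theorem RightExt.lt_iff_inv_lt {V A : Type*} {x y : RightExt V A} : x < y ↔ x.inv < y.inv :=
  Iff.rfl

namespace StringAlgebra

variable {V A : Type*} {Λ : StringAlgebra V A}

/-! ### Lists of syllables that are strings -/

theorem sylSrc_flip (α : Syllable A) : Λ.sylSrc α.flip = Λ.sylTgt α := by cases α <;> rfl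

theorem sylTgt_flip (α : Syllable A) : Λ.sylTgt α.flip = Λ.sylSrc α := by cases α <;> rfl

theorem sylσ_flip (α : Syllable A) : Λ.sylσ α.flip = Λ.sylε α := by cases α <;> rfl

theorem IsStringList.infix {l l' : List (Syllable A)} (h : Λ.IsStringList l) (h' : l' <:+: l) :
    Λ.IsStringList l' :=
  ⟨h.1.infix h', h.2.1.infix h', fun p hp =>
    ⟨fun hi => (h.2.2 p hp).1 (hi.trans h'), fun hi => (h.2.2 p hp).2 (hi.trans h')⟩⟩

theorem IsStringList.inv {l : List (Syllable A)} (h : Λ.IsStringList l) :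
    Λ.IsStringList (l.reverse.map Syllable.flip) := by
  have hid : Syllable.flip ∘ Syllable.flip = (id : Syllable A → Syllable A) :=
    funext Syllable.flip_flip
  refine ⟨?_, ?_, fun p hp => ⟨fun hi => (h.2.2 p hp).2 ?_, fun hi => (h.2.2 p hp).1 ?_⟩⟩
  · rw [List.isChain_map, List.isChain_reverse]
    exact h.1.imp fun α β hαβ => by rw [sylSrc_flip, sylTgt_flip, hαβ]
  · rw [List.isChain_map, List.isChain_reverse]
    refine h.2.1.imp fun α β hαβ he => hαβ ?_
    rw [Syllable.flip_flip] at he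
    exact he.symm
  · have := List.reverse_infix.2 (hi.map Syllable.flip)
    rwa [List.map_map, List.map_map, hid, List.map_id, List.reverse_reverse] at this
  · have := List.reverse_infix.2 (hi.map Syllable.flip)
    rwa [List.map_map, hid, List.map_id, List.reverse_reverse, List.map_reverse,
      List.reverse_reverse, List.map_map] at this

variable (Λ) in
/-- The list `x` may be followed by the list `y` at a peak: `x` ends with a direct syllable, `y`
begins with an inverse syllable with the same target that is not the inverse of the former. The
condition is empty if one of the lists is. -/
def IsPeak (x y : List (Syllable A)) : Prop :=
  ∀ α ∈ x.getLast?, ∀ β ∈ y.head?,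
    α.IsDirect ∧ β.IsInverse ∧ Λ.sylTgt α = Λ.sylSrc β ∧ β ≠ α.flip

/-- Strings can be glued at a peak, since no path in `ρ ∪ ρ⁻¹` runs across a change of
direction. -/
theorem IsStringList.append {x y : List (Syllable A)} (hx : Λ.IsStringList x)
    (hy : Λ.IsStringList y) (h : Λ.IsPeak x y) : Λ.IsStringList (x ++ y) := by
  refine ⟨hx.1.append hy.1 fun α hα β hβ => (h α hα β hβ).2.2.1,
    hx.2.1.append hy.2.1 fun α hα β hβ => (h α hα β hβ).2.2.2, fun p hp => ?_⟩
  -- A part that runs across the peak contains syllables of both directions.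
  have key : ∀ l₁ l₂ : List (Syllable A), l₁ ≠ [] → l₂ ≠ [] → l₁ <:+ x → l₂ <+: y →
      (∃ α ∈ l₁, α.IsDirect) ∧ ∃ β ∈ l₂, β.IsInverse := by
    rintro l₁ l₂ h₁ h₂ ⟨x', rfl⟩ ⟨y', rfl⟩
    have := h (l₁.getLast h₁)
      (by rw [List.getLast?_append_of_ne_nil _ h₁, List.getLast?_eq_getLast_of_ne_nil h₁]; rfl)
      (l₂.head h₂) (by rw [List.head?_append_of_ne_nil _ h₂, List.head?_eq_some_head h₂]; rfl)
    exact ⟨⟨_, List.getLast_mem h₁, this.1⟩, ⟨_, List.head_mem h₂, this.2.1⟩⟩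
  constructor
  · intro hi
    rcases List.infix_append_iff_ne_nil.1 hi with hi | hi | ⟨l₁, l₂, h₁, h₂, he, hs, ht⟩
    · exact (hx.2.2 p hp).1 hi
    · exact (hy.2.2 p hp).1 hi
    · obtain ⟨-, β, hβ, hd⟩ := key l₁ l₂ h₁ h₂ hs ht
      have : β ∈ p.map Syllable.dir := by rw [he]; exact List.mem_append_right _ hβ
      obtain ⟨a, -, rfl⟩ := List.mem_map.1 this
      exact hd
  · intro hi
    rcases List.infix_append_iff_ne_nil.1 hi with hi | hi | ⟨l₁, l₂, h₁, h₂, he, hs, ht⟩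
    · exact (hx.2.2 p hp).2 hi
    · exact (hy.2.2 p hp).2 hi
    · obtain ⟨⟨β, hβ, hd⟩, -⟩ := key l₁ l₂ h₁ h₂ hs ht
      have : β ∈ (p.map Syllable.inv).reverse := by rw [he]; exact List.mem_append_left _ hβ
      obtain ⟨a, -, rfl⟩ := List.mem_map.1 (List.mem_reverse.1 this)
      exact hd

/-- Consecutive syllables of a string are also compatible with respect to the signs. -/
theorem IsStringList.sign {α β : Syllable A} (h : Λ.IsStringList [α, β]) :
    Λ.sylTgt α = Λ.sylSrc β ∧ Λ.sylσ β = -Λ.sylε α := by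
  obtain ⟨h1, h2, h3⟩ := h
  simp only [List.isChain_cons_cons, List.isChain_singleton, and_true] at h1 h2
  refine ⟨h1, ?_⟩
  cases α with
  | dir a =>
    cases β with
    | dir b =>
      refine Λ.σ_eq_neg_ε a b h1 ?_
      rintro ⟨q, hq, hi⟩
      exact (h3 q hq).1 (hi.map Syllable.dir)
    | inv b =>
      refine Λ.ε_ne b a ?_ h1.symm
      rintro rfl
      exact h2 rfl
  | inv a =>
    cases β with
    | dir b =>
      refine Λ.σ_ne b a ?_ h1.symm
      rintro rfl
      exact h2 rfl
    | inv b =>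
      have : Λ.σ a = -Λ.ε b := by
        refine Λ.σ_eq_neg_ε b a h1.symm ?_
        rintro ⟨q, hq, hi⟩
        have := List.reverse_infix.2 (hi.map Syllable.inv)
        exact (h3 q hq).2 (by simpa using this)
      change Λ.ε b = -Λ.σ a
      rw [this, neg_neg]

/-- A syllable is determined by its source, its sign and its direction. -/
theorem syllable_eq_of_rank_eq {α β : Syllable A} (hs : Λ.sylSrc α = Λ.sylSrc β)
    (hσ : Λ.sylσ α = Λ.sylσ β) (hr : LeftExt.rank (some α) = LeftExt.rank (some β)) : α = β := by
  have hne : ∀ i : ℤˣ, i ≠ -i := by decide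
  cases α with
  | dir a =>
    cases β with
    | dir b =>
      by_contra h
      have := Λ.σ_ne a b (fun h' => h (by rw [h'])) hs
      change Λ.σ a = Λ.σ b at hσ
      exact hne _ (hσ.symm.trans this)
    | inv b => simp [LeftExt.rank] at hr
  | inv a =>
    cases β with
    | dir b => simp [LeftExt.rank] at hr
    | inv b =>
      by_contra h
      have := Λ.ε_ne a b (fun h' => h (by rw [h'])) hs
      change Λ.ε a = Λ.ε b at hσ
      exact hne _ (hσ.symm.trans this)

/-! ### The order is total on strings with a fixed start -/

variable (Λ) in
/-- The syllables of `x` are composable and compatible with the signs, and the first one (if there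
is one) has source `v` and sign `i`. -/
structure IsCoherent (v : V) (i : ℤˣ) (x : LeftExt V A) : Prop where
  zero : ∀ α, x.syl 0 = some α → Λ.sylSrc α = v ∧ Λ.sylσ α = i
  succ : ∀ k α β, x.syl k = some α → x.syl (k + 1) = some β →
    Λ.sylTgt α = Λ.sylSrc β ∧ Λ.sylσ β = -Λ.sylε α

theorem isCoherent_fin {w : Word V A} (hw : Λ.IsString w) {v : V} {i : ℤˣ} (hs : Λ.s w = v)
    (hσ : Λ.wordσ w = i) : Λ.IsCoherent v i (.fin w) where
  zero α hα := by
    cases w with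
    | one => simp [Word.toList] at hα
    | path l h =>
      obtain rfl : l.head h = α := by
        have : l.head? = some α := by simpa [Word.toList, List.head?_eq_getElem?] using hα
        rwa [List.head?_eq_some_head h, Option.some_inj] at this
      exact ⟨hs, hσ⟩
  succ k α β hα hβ := by
    rw [LeftExt.syl_fin] at hα hβ
    obtain ⟨h₁, rfl⟩ := List.getElem?_eq_some_iff.1 hα
    obtain ⟨h₂, rfl⟩ := List.getElem?_eq_some_iff.1 hβ
    refine (IsStringList.infix hw ⟨w.toList.take k, w.toList.drop (k + 2), ?_⟩).sign
    conv_rhs => rw [← List.take_append_drop k w.toList, List.drop_eq_getElem_cons h₁,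
      List.drop_eq_getElem_cons h₂]
    simp

theorem isCoherent_inf {f : Stream' (Syllable A)} (hf : ∀ n, Λ.IsStringList (f.take n)) :
    Λ.IsCoherent (Λ.sylSrc f.head) (Λ.sylσ f.head) (.inf f) where
  zero α hα := by
    obtain rfl : f.head = α := Option.some_inj.1 hα
    exact ⟨rfl, rfl⟩
  succ k α β hα hβ := by
    obtain rfl : f.get k = α := Option.some_inj.1 hα
    obtain rfl : f.get (k + 1) = β := Option.some_inj.1 hβ
    refine ((hf (k + 2)).infix ⟨f.take k, [], ?_⟩).sign
    rw [Stream'.take_succ', Stream'.take_succ', List.append_nil, List.append_assoc]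
    rfl

theorem IsCoherent.trichotomy {v : V} {i : ℤˣ} {x y : LeftExt V A} (hx : Λ.IsCoherent v i x)
    (hy : Λ.IsCoherent v i y) : (∀ k, x.syl k = y.syl k) ∨ x.SLt y ∨ y.SLt x := by
  classical
  by_cases h : ∃ k, x.syl k ≠ y.syl k
  swap
  · left
    push Not at h
    exact h
  right
  obtain ⟨k, hk, hmin⟩ : ∃ k, x.syl k ≠ y.syl k ∧ ∀ j < k, x.syl j = y.syl j :=
    ⟨Nat.find h, Nat.find_spec h, fun j hj => not_not.1 (Nat.find_min h hj)⟩
  suffices hr : LeftExt.rank (x.syl k) ≠ LeftExt.rank (y.syl k) by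
    rcases lt_or_gt_of_ne hr with hr | hr
    · exact Or.inl ⟨k, hmin, hr⟩
    · exact Or.inr ⟨k, fun j hj => (hmin j hj).symm, hr⟩
  intro hr
  cases hα : x.syl k with
  | none =>
    cases hβ : y.syl k with
    | none => exact hk (hα.trans hβ.symm)
    | some β => rw [hα, hβ] at hr; cases β <;> simp [LeftExt.rank] at hr
  | some α =>
    cases hβ : y.syl k with
    | none => rw [hα, hβ] at hr; cases α <;> simp [LeftExt.rank] at hr
    | some β =>
      rw [hα, hβ] at hr
      suffices hs : Λ.sylSrc α = Λ.sylSrc β ∧ Λ.sylσ α = Λ.sylσ β by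
        exact hk (by rw [hα, hβ, syllable_eq_of_rank_eq hs.1 hs.2 hr])
      cases k with
      | zero =>
        obtain ⟨h₁, h₂⟩ := hx.zero α hα
        obtain ⟨h₃, h₄⟩ := hy.zero β hβ
        exact ⟨h₁.trans h₃.symm, h₂.trans h₄.symm⟩
      | succ k =>
        obtain ⟨γ, hγ⟩ := LeftExt.syl_succ_isSome hα
        obtain ⟨h₁, h₂⟩ := hx.succ k γ α hγ hα
        obtain ⟨h₃, h₄⟩ := hy.succ k γ β ((hmin k k.lt_succ_self).symm.trans hγ) hβ
        exact ⟨h₁.symm.trans h₃, h₂.trans h₄.symm⟩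

/-! ### Bands and their equivalence classes -/

variable (Λ) in
/-- The lists of syllables of bands. -/
structure IsBandList (l : List (Syllable A)) : Prop where
  ne_nil : l ≠ []
  string : Λ.IsStringList l
  peak : Λ.IsPeak l l
  primitive : ∀ x n, x <+: l → 2 ≤ n → l ≠ (List.replicate n x).flatten

theorem IsBand.isBandList {b : Word V A} (hb : Λ.IsBand b) : Λ.IsBandList b.toList := by
  obtain ⟨hs, ⟨hne, hd, hi⟩, ⟨-, h2⟩, hp⟩ := hb
  refine ⟨hne, hs, ?_, fun x n hx hn he => ?_⟩
  · rw [IsString, Word.toList_comp] at h2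
    intro α hα β hβ
    refine ⟨?_, ?_, (List.isChain_append.1 h2.1).2.2 α hα β hβ,
      (List.isChain_append.1 h2.2.1).2.2 α hα β hβ⟩
    · rw [List.getLast?_eq_getLast_of_ne_nil hne, Option.mem_some_iff] at hα
      exact hα ▸ hd
    · rw [List.head?_eq_some_head hne, Option.mem_some_iff] at hβ
      exact hβ ▸ hi
  · have hxne : x ≠ [] := by
      rintro rfl
      exact hne (by simpa using he)
    exact hp ⟨.path x hxne, n, hs.infix hx.isInfix, hn, he⟩

theorem composable_path {l m : List (Syllable A)} (hl : l ≠ []) (hm : m ≠ [])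
    (h : Λ.IsStringList (l ++ m)) : Λ.Composable (.path m hm) (.path l hl) := by
  refine ⟨(h.1.rel_getLast_head_of_append hl hm).symm, ?_⟩
  rintro (h | h)
  · exact absurd h hm
  · exact absurd h hl

theorem composable_of_toList_ne_nil {u x : Word V A} (hu : u.toList ≠ []) (hx : x.toList ≠ [])
    (h : Λ.IsStringList (x.toList ++ u.toList)) : Λ.Composable u x := by
  rw [Word.eq_path_of_toList_ne_nil hu, Word.eq_path_of_toList_ne_nil hx]
  exact composable_path hx hu h

/-- Once the syllables of `y u x` form a string, the zero-length word `u` can be chosen such that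
the compositions are defined. -/
theorem exists_isString₃ {x y : Word V A} (hx : x.toList ≠ []) (hy : y.toList ≠ [])
    {m : List (Syllable A)} (h : Λ.IsStringList (x.toList ++ m ++ y.toList)) :
    ∃ u, Λ.IsString u ∧ Λ.IsString₃ y u x ∧ u.toList = m := by
  obtain ⟨u, rfl, hu⟩ : ∃ u : Word V A, u.toList = m ∧ Λ.Composable u x := by
    by_cases hm : m = []
    · exact ⟨.one (Λ.t x) (Λ.wordε x), hm.symm, rfl, fun _ => rfl⟩
    · exact ⟨.path m hm, rfl, composable_of_toList_ne_nil hm hx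
        (h.infix ⟨[], y.toList, by simp [Word.toList]⟩)⟩
  refine ⟨u, h.infix ⟨x.toList, y.toList, rfl⟩, ⟨hu, ?_, ?_⟩, rfl⟩
  · refine composable_of_toList_ne_nil hy ?_ ?_
    · rw [Word.toList_comp]; simp [hx]
    · rwa [Word.toList_comp]
  · rwa [IsString, Word.toList_comp, Word.toList_comp]

theorem IsString₃.isStringList {x u y : Word V A} (h : Λ.IsString₃ y u x) :
    Λ.IsStringList (x.toList ++ u.toList ++ y.toList) := by
  have := h.2.2
  rwa [IsString, Word.toList_comp, Word.toList_comp] at this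

theorem Reaches.of_isStringList {x y : Word V A} (hx : x.toList ≠ []) (hy : y.toList ≠ [])
    {m : List (Syllable A)} (h : Λ.IsStringList (x.toList ++ m ++ y.toList)) : Λ.Reaches x y := by
  obtain ⟨u, hu, h3, -⟩ := exists_isString₃ hx hy h
  exact ⟨u, hu, h3⟩

theorem Reaches.exists_isStringList {x y : Word V A} (h : Λ.Reaches x y) :
    ∃ m, Λ.IsStringList (x.toList ++ m ++ y.toList) := by
  obtain ⟨u, -, h3⟩ := h
  exact ⟨u.toList, h3.isStringList⟩

theorem IsPeak.congr {x y x' y' : List (Syllable A)} (h : Λ.IsPeak x y)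
    (hx : x'.getLast? = x.getLast?) (hy : y'.head? = y.head?) : Λ.IsPeak x' y' := by
  unfold IsPeak
  rw [hx, hy]
  exact h

theorem Reaches.of_getLast?_eq {b c : Word V A} (hb : Λ.IsBand b) (hc : Λ.IsBand c)
    (h : b.toList.getLast? = c.toList.getLast?) : Λ.Reaches b c := by
  refine .of_isStringList hb.isBandList.ne_nil hc.isBandList.ne_nil (m := []) ?_
  rw [List.append_nil]
  exact hb.isBandList.string.append hc.isBandList.string (hc.isBandList.peak.congr h rfl)

theorem Reaches.trans {x y z : Word V A} (hy : Λ.IsBand y) (hx : x.toList ≠ [])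
    (hz : z.toList ≠ []) (hxy : Λ.Reaches x y) (hyz : Λ.Reaches y z) : Λ.Reaches x z := by
  obtain ⟨m, hm⟩ := hxy.exists_isStringList
  obtain ⟨m', hm'⟩ := hyz.exists_isStringList
  have hne := hy.isBandList.ne_nil
  refine .of_isStringList hx hz (m := m ++ y.toList ++ (y.toList ++ m')) ?_
  have := hm.append hm' (hy.isBandList.peak.congr
    (by rw [List.getLast?_append_of_ne_nil _ hne])
    (by rw [List.append_assoc, List.head?_append_of_ne_nil _ hne]))
  simpa using this

theorem Reaches.refl {b : Word V A} (hb : Λ.IsBand b) : Λ.Reaches b b :=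
  .of_getLast?_eq hb hb rfl

theorem isBand_of_mem_QBa {Q₀ : Set (Word V A)} (hQ₀ : Λ.IsBandTransversal Q₀)
    {B : Set (Word V A)} (hB : B ∈ Λ.QBa Q₀) {b : Word V A} (hb : b ∈ B) : Λ.IsBand b := by
  obtain ⟨b₀, -, rfl⟩ := hB
  exact hQ₀.1 b hb.1

theorem mem_of_getLast?_eq {Q₀ : Set (Word V A)} (hQ₀ : Λ.IsBandTransversal Q₀)
    {B C : Set (Word V A)} (hB : B ∈ Λ.QBa Q₀) (hC : C ∈ Λ.QBa Q₀) {b c : Word V A} (hb : b ∈ B)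
    (hc : c ∈ C) (h : b.toList.getLast? = c.toList.getLast?) : c ∈ B := by
  have hbb := isBand_of_mem_QBa hQ₀ hB hb
  have hcb := isBand_of_mem_QBa hQ₀ hC hc
  obtain ⟨b₀, hb₀, rfl⟩ := hB
  obtain ⟨c₀, hc₀, rfl⟩ := hC
  have hne := (hQ₀.1 _ hb₀).isBandList.ne_nil
  exact ⟨hc.1, hb.2.1.trans hbb hne hcb.isBandList.ne_nil (.of_getLast?_eq hbb hcb h),
    (Reaches.of_getLast?_eq hcb hbb h.symm).trans hbb hcb.isBandList.ne_nil hne hb.2.2⟩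

/-! ### Finiteness of the extremal bands -/

theorem pow_eq {b : Word V A} (hb : b.toList ≠ []) :
    LeftExt.pow b = .inf (Stream'.cycle b.toList hb) := by
  cases b
  · exact absurd rfl hb
  · rfl

theorem powComp_eq {b : Word V A} (hb : b.toList ≠ []) (x : Word V A) :
    LeftExt.powComp b x = .inf (x.toList ++ₛ Stream'.cycle b.toList hb) := by
  cases b
  · exact absurd rfl hb
  · rfl

/-- Two bands with the same last syllable can be composed in both orders, so if both are extremal
in the same direction, their left infinite powers bound each other and agree. -/
theorem eq_of_getLast?_eq {b c : Word V A} (hb : Λ.IsBand b) (hc : Λ.IsBand c)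
    (h : b.toList.getLast? = c.toList.getLast?)
    (hbc : (∀ u, Λ.IsString u → Λ.IsString₃ c u b →
      LeftExt.pow b ≤ LeftExt.powComp c (u.comp b)) ∧
      (∀ u, Λ.IsString u → Λ.IsString₃ b u c → LeftExt.pow c ≤ LeftExt.powComp b (u.comp c)) ∨
      (∀ u, Λ.IsString u → Λ.IsString₃ c u b →
      LeftExt.powComp c (u.comp b) ≤ LeftExt.pow b) ∧
      (∀ u, Λ.IsString u → Λ.IsString₃ b u c → LeftExt.powComp b (u.comp c) ≤ LeftExt.pow c)) :
    b = c := by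
  have hbl := hb.isBandList
  have hcl := hc.isBandList
  have aux : ∀ b c : Word V A, (hb : Λ.IsBand b) → (hc : Λ.IsBand c) →
      b.toList.getLast? = c.toList.getLast? → ∃ u, Λ.IsString u ∧ Λ.IsString₃ c u b ∧
        LeftExt.powComp c (u.comp b) = (.inf (b.toList ++ₛ
          Stream'.cycle c.toList hc.isBandList.ne_nil) : LeftExt V A) := by
    intro b c hb hc h
    obtain ⟨u, hu, h3, hnil⟩ := exists_isString₃ (m := [])
      hb.isBandList.ne_nil hc.isBandList.ne_nil (by
        rw [List.append_nil]
        exact hb.isBandList.string.append hc.isBandList.string (hc.isBandList.peak.congr h rfl))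
    refine ⟨u, hu, h3, ?_⟩
    rw [powComp_eq hc.isBandList.ne_nil, Word.toList_comp, hnil, List.append_nil]
  obtain ⟨u, hu, hu3, hu'⟩ := aux b c hb hc h
  obtain ⟨w, hw, hw3, hw'⟩ := aux c b hc hb h.symm
  have heq : Stream'.cycle b.toList hbl.ne_nil = Stream'.cycle c.toList hcl.ne_nil := by
    suffices h : (LeftExt.inf (Stream'.cycle b.toList hbl.ne_nil) : LeftExt V A) =
        .inf (Stream'.cycle c.toList hcl.ne_nil) from LeftExt.inf.inj h
    rcases hbc with ⟨h₁, h₂⟩ | ⟨h₁, h₂⟩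
    · have h₁ := h₁ u hu hu3
      have h₂ := h₂ w hw hw3
      rw [hu', pow_eq hbl.ne_nil, Stream'.cycle_eq b.toList, LeftExt.inf_append_le_iff] at h₁
      rw [hw', pow_eq hcl.ne_nil, Stream'.cycle_eq c.toList, LeftExt.inf_append_le_iff] at h₂
      exact le_antisymm h₁ h₂
    · have h₁ := h₁ u hu hu3
      have h₂ := h₂ w hw hw3
      rw [hu', pow_eq hbl.ne_nil, Stream'.cycle_eq b.toList, LeftExt.inf_append_le_iff] at h₁
      rw [hw', pow_eq hcl.ne_nil, Stream'.cycle_eq c.toList, LeftExt.inf_append_le_iff] at h₂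
      exact le_antisymm h₂ h₁
  have := Stream'.eq_of_cycle_eq hbl.ne_nil hcl.ne_nil heq hbl.primitive hcl.primitive
  rw [Word.eq_path_of_toList_ne_nil hbl.ne_nil, Word.eq_path_of_toList_ne_nil hcl.ne_nil]
  simp only [this]

theorem finite_iUnion_Bal_union_BalBar [Finite A] {Q₀ : Set (Word V A)}
    (hQ₀ : Λ.IsBandTransversal Q₀) : (⋃ B ∈ Λ.QBa Q₀, (Λ.Bal B ∪ Λ.BalBar B)).Finite := by
  have fin : ∀ S : Set (Word V A), Set.InjOn (fun b => b.toList.getLast?) S → S.Finite :=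
    fun S hS => Set.Finite.of_finite_image (Set.toFinite _) hS
  have h₁ : (⋃ B ∈ Λ.QBa Q₀, Λ.Bal B).Finite := by
    refine fin _ fun b hb c hc h => ?_
    simp only [Set.mem_iUnion] at hb hc
    obtain ⟨B, hB, hb, hb'⟩ := hb
    obtain ⟨C, hC, hc, hc'⟩ := hc
    exact eq_of_getLast?_eq (isBand_of_mem_QBa hQ₀ hB hb) (isBand_of_mem_QBa hQ₀ hC hc) h
      (Or.inl ⟨hb' c (mem_of_getLast?_eq hQ₀ hB hC hb hc h),
        hc' b (mem_of_getLast?_eq hQ₀ hC hB hc hb h.symm)⟩)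
  have h₂ : (⋃ B ∈ Λ.QBa Q₀, Λ.BalBar B).Finite := by
    refine fin _ fun b hb c hc h => ?_
    simp only [Set.mem_iUnion] at hb hc
    obtain ⟨B, hB, hb, hb'⟩ := hb
    obtain ⟨C, hC, hc, hc'⟩ := hc
    exact eq_of_getLast?_eq (isBand_of_mem_QBa hQ₀ hB hb) (isBand_of_mem_QBa hQ₀ hC hc) h
      (Or.inr ⟨hb' c (mem_of_getLast?_eq hQ₀ hB hC hb hc h),
        hc' b (mem_of_getLast?_eq hQ₀ hC hB hc hb h.symm)⟩)
  refine (h₁.union h₂).subset ?_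
  simp only [Set.iUnion_subset_iff]
  rintro B hB b (hb | hb)
  · exact Or.inl (Set.mem_biUnion hB hb)
  · exact Or.inr (Set.mem_biUnion hB hb)

/-! ### Loops at a band -/

variable (Λ) in
/-- A string that begins and ends with the same syllables as the list `l`. If `l` is the list of a
band, then any sequence of such strings can be concatenated. -/
structure IsLoop (l x : List (Syllable A)) : Prop where
  string : Λ.IsStringList x
  head : x.head? = l.head?
  last : x.getLast? = l.getLast?

theorem IsBandList.isLoop {l : List (Syllable A)} (hl : Λ.IsBandList l) : Λ.IsLoop l l :=
  ⟨hl.string, rfl, rfl⟩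

theorem IsLoop.ne_nil {l x : List (Syllable A)} (hl : Λ.IsBandList l) (hx : Λ.IsLoop l x) :
    x ≠ [] := by
  rintro rfl
  have := hx.head
  rw [List.head?_eq_some_head hl.ne_nil] at this
  simp at this

theorem isStringList_flatten_append {l : List (Syllable A)} (hl : Λ.IsBandList l)
    {L : List (List (Syllable A))} (hL : ∀ x ∈ L, Λ.IsLoop l x) {y : List (Syllable A)}
    (hy : Λ.IsStringList y) (hh : y.head? = l.head?) :
    Λ.IsStringList (L.flatten ++ y) ∧ (L.flatten ++ y).head? = l.head? := by
  induction L with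
  | nil => exact ⟨hy, hh⟩
  | cons x L ih =>
    obtain ⟨h₁, h₂⟩ := ih fun z hz => hL z (List.mem_cons_of_mem _ hz)
    have hx := hL x List.mem_cons_self
    rw [List.flatten_cons, List.append_assoc]
    refine ⟨hx.string.append h₁ (hl.peak.congr hx.last h₂), ?_⟩
    rw [List.head?_append_of_ne_nil _ (hx.ne_nil hl), hx.head]

theorem exists_replicate_eq_take {l : List (Syllable A)} (hl : l ≠ []) (n : ℕ) :
    ∃ r, (List.replicate n l).flatten = (Stream'.cycle l hl).take n ++ r := by
  have hlen : n ≤ (List.replicate n l).flatten.length := by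
    rw [List.length_flatten, List.map_replicate, List.sum_replicate, smul_eq_mul]
    exact Nat.le_mul_of_pos_right _ (List.length_pos_of_ne_nil hl)
  refine ⟨(List.replicate n l).flatten.drop n, ?_⟩
  rw [Stream'.cycle_eq_replicate_append hl n, Stream'.take_append_of_le_length _ _ _ hlen,
    List.take_append_drop]

theorem isStringList_take_cycle {l : List (Syllable A)} (hl : Λ.IsBandList l) (n : ℕ) :
    Λ.IsStringList ((Stream'.cycle l hl.ne_nil).take n) := by
  obtain ⟨r, hr⟩ := exists_replicate_eq_take hl.ne_nil n
  have := (isStringList_flatten_append hl (L := List.replicate n l)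
    (fun x hx => (List.eq_of_mem_replicate hx) ▸ hl.isLoop) hl.string rfl).1
  rw [hr] at this
  exact this.infix ⟨[], r ++ l, by simp⟩

/-- If a band `l'` can be reached from the band `l` along `m`, and `l` can be reached from `l'`,
then every initial part of `⋯ l' l' m l` extends to a loop at `l`. -/
theorem exists_isLoop_take_append {l l' m m' : List (Syllable A)} (hl : Λ.IsBandList l)
    (hl' : Λ.IsBandList l') (h : Λ.IsStringList (l ++ m ++ l'))
    (h' : Λ.IsStringList (l' ++ m' ++ l)) (k : ℕ) :
    ∃ r, Λ.IsLoop l (((l ++ m) ++ₛ Stream'.cycle l' hl'.ne_nil).take k ++ r) := by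
  have hhead : (l' ++ m' ++ l).head? = l'.head? := by
    rw [List.append_assoc, List.head?_append_of_ne_nil _ hl'.ne_nil]
  obtain ⟨hs, hh⟩ := isStringList_flatten_append hl' (L := List.replicate k l')
    (fun x hx => (List.eq_of_mem_replicate hx) ▸ hl'.isLoop) h' hhead
  have hloop : Λ.IsLoop l
      (l ++ m ++ l' ++ ((List.replicate k l').flatten ++ (l' ++ m' ++ l))) := by
    refine ⟨h.append hs (hl'.peak.congr
      (by rw [List.getLast?_append_of_ne_nil _ hl'.ne_nil]) hh), ?_, ?_⟩
    · simp only [List.append_assoc]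
      rw [List.head?_append_of_ne_nil _ hl.ne_nil]
    · rw [← List.append_assoc, ← List.append_assoc (as := l ++ m ++ l' ++ _),
        List.getLast?_append_of_ne_nil _ hl.ne_nil]
  obtain ⟨r, hr⟩ := exists_replicate_eq_take hl'.ne_nil k
  have hlen : k ≤ ((l ++ m) ++ (l' ++ (List.replicate k l').flatten)).length := by
    simp only [List.length_append, hr, Stream'.length_take]
    omega
  have htake : ((l ++ m) ++ₛ Stream'.cycle l' hl'.ne_nil).take k =
      ((l ++ m) ++ (l' ++ (List.replicate k l').flatten)).take k := by
    rw [Stream'.cycle_eq l' hl'.ne_nil, Stream'.cycle_eq_replicate_append hl'.ne_nil k,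
      ← Stream'.append_append_stream, ← Stream'.append_append_stream, List.append_assoc (l ++ m),
      Stream'.take_append_of_le_length _ _ _ hlen]
  refine ⟨((l ++ m) ++ (l' ++ (List.replicate k l').flatten)).drop k ++ (l' ++ m' ++ l), ?_⟩
  rw [htake, ← List.append_assoc, List.take_append_drop]
  simpa only [List.append_assoc] using hloop

/-- For bands `b` and `c` in the same class, the sequence `⋯ c c u b` either agrees with
`⋯ b b b`, or it leaves it at some index along a loop at `b`. -/
theorem exists_branch {b c u : Word V A} (hb : Λ.IsBand b) (hc : Λ.IsBand c)
    (h : Λ.IsString₃ c u b) (hcb : Λ.Reaches c b) :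
    LeftExt.powComp c (u.comp b) = LeftExt.pow b ∨
      ∃ (k : ℕ) (α : Syllable A) (r : List (Syllable A)),
      Λ.IsLoop b.toList ((Stream'.cycle b.toList hb.isBandList.ne_nil).take k ++ (α :: r)) ∧
      (LeftExt.powComp c (u.comp b) < LeftExt.pow b ∧ LeftExt.rank (some α) <
        LeftExt.rank (some ((Stream'.cycle b.toList hb.isBandList.ne_nil).get k)) ∨
      LeftExt.pow b < LeftExt.powComp c (u.comp b) ∧
        LeftExt.rank (some ((Stream'.cycle b.toList hb.isBandList.ne_nil).get k)) <
        LeftExt.rank (some α)) := by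
  have hbl := hb.isBandList
  have hcl := hc.isBandList
  obtain ⟨m', hm'⟩ := hcb.exists_isStringList
  have hloop := exists_isLoop_take_append hbl hcl h.isStringList hm'
  rw [pow_eq hbl.ne_nil, powComp_eq hcl.ne_nil, Word.toList_comp]
  set g := Stream'.cycle b.toList hbl.ne_nil with hg
  set f := (b.toList ++ u.toList) ++ₛ Stream'.cycle c.toList hcl.ne_nil with hf
  have hgc : Λ.IsCoherent (Λ.sylSrc g.head) (Λ.sylσ g.head) (.inf g) :=
    isCoherent_inf (isStringList_take_cycle hbl)
  have hfc : Λ.IsCoherent (Λ.sylSrc g.head) (Λ.sylσ g.head) (.inf f) := by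
    have hhead : f.head = g.head := by
      change f.get 0 = g.get 0
      have hpos := List.length_pos_of_ne_nil hbl.ne_nil
      rw [hf, hg, Stream'.cycle_eq b.toList, Stream'.append_append_stream,
        Stream'.get_append_left _ _ _ hpos, Stream'.get_append_left _ _ _ hpos]
    rw [← hhead]
    refine isCoherent_inf fun n => ?_
    obtain ⟨r, hr⟩ := hloop n
    exact hr.string.infix ⟨[], r, rfl⟩
  have key : ∀ k, (∀ j < k, f.get j = g.get j) → ∃ r : List (Syllable A), Λ.IsLoop b.toList
      (g.take k ++ (f.get k :: r)) := by
    intro k hk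
    obtain ⟨r, hr⟩ := hloop (k + 1)
    refine ⟨r, ?_⟩
    have : g.take k = f.take k := by
      refine List.ext_getElem (by simp) fun j h₁ h₂ => ?_
      rw [Stream'.take_get, Stream'.take_get, hk j (by simpa using h₁)]
    rw [this]
    rw [Stream'.take_succ', List.append_assoc] at hr
    exact hr
  rcases hfc.trichotomy hgc with he | hlt | hlt
  · left
    congr 1
    ext k
    exact Option.some_inj.1 (he k)
  · right
    obtain ⟨k, hk, hr⟩ := id hlt
    obtain ⟨r, hloop⟩ := key k fun j hj => Option.some_inj.1 (hk j hj)
    exact ⟨k, f.get k, r, hloop, Or.inl ⟨hlt.lt, hr⟩⟩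
  · right
    obtain ⟨k, hk, hr⟩ := id hlt
    obtain ⟨r, hloop⟩ := key k fun j hj => (Option.some_inj.1 (hk j hj)).symm
    exact ⟨k, f.get k, r, hloop, Or.inr ⟨hlt.lt, hr⟩⟩

theorem reaches_of_mem_QBa {Q₀ : Set (Word V A)} (hQ₀ : Λ.IsBandTransversal Q₀)
    {B : Set (Word V A)} (hB : B ∈ Λ.QBa Q₀) {b c : Word V A} (hb : b ∈ B) (hc : c ∈ B) :
    Λ.Reaches b c := by
  have hbb := isBand_of_mem_QBa hQ₀ hB hb
  have hcb := isBand_of_mem_QBa hQ₀ hB hc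
  obtain ⟨b₀, hb₀, rfl⟩ := hB
  exact hb.2.2.trans (hQ₀.1 _ hb₀) hbb.isBandList.ne_nil hcb.isBandList.ne_nil hc.2.1

theorem exists_branch_lt_of_not_mem_Bal {Q₀ : Set (Word V A)} (hQ₀ : Λ.IsBandTransversal Q₀)
    {B : Set (Word V A)} (hB : B ∈ Λ.QBa Q₀) {b : Word V A} (hb : b ∈ B)
    (hbb : Λ.IsBandList b.toList) (h : b ∉ Λ.Bal B) :
    ∃ (k : ℕ) (α : Syllable A) (r : List (Syllable A)),
      Λ.IsLoop b.toList ((Stream'.cycle b.toList hbb.ne_nil).take k ++ (α :: r)) ∧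
      LeftExt.rank (some α) < LeftExt.rank (some ((Stream'.cycle b.toList hbb.ne_nil).get k)) := by
  rw [Bal, Set.mem_ofPred_eq] at h
  push Not at h
  obtain ⟨c, hc, u, hu, h3, hle⟩ := h hb
  rcases exists_branch (isBand_of_mem_QBa hQ₀ hB hb) (isBand_of_mem_QBa hQ₀ hB hc) h3
    (reaches_of_mem_QBa hQ₀ hB hc hb) with he | ⟨k, α, r, hloop, ⟨-, hlt⟩ | ⟨hlt, -⟩⟩
  · exact absurd he.ge hle
  · exact ⟨k, α, r, hloop, hlt⟩
  · exact absurd hlt.le hle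

theorem exists_branch_gt_of_not_mem_BalBar {Q₀ : Set (Word V A)} (hQ₀ : Λ.IsBandTransversal Q₀)
    {B : Set (Word V A)} (hB : B ∈ Λ.QBa Q₀) {b : Word V A} (hb : b ∈ B)
    (hbb : Λ.IsBandList b.toList) (h : b ∉ Λ.BalBar B) :
    ∃ (k : ℕ) (α : Syllable A) (r : List (Syllable A)),
      Λ.IsLoop b.toList ((Stream'.cycle b.toList hbb.ne_nil).take k ++ (α :: r)) ∧
      LeftExt.rank (some ((Stream'.cycle b.toList hbb.ne_nil).get k)) < LeftExt.rank (some α) := by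
  rw [BalBar, Set.mem_ofPred_eq] at h
  push Not at h
  obtain ⟨c, hc, u, hu, h3, hle⟩ := h hb
  rcases exists_branch (isBand_of_mem_QBa hQ₀ hB hb) (isBand_of_mem_QBa hQ₀ hB hc) h3
    (reaches_of_mem_QBa hQ₀ hB hc hb) with he | ⟨k, α, r, hloop, ⟨hlt, -⟩ | ⟨-, hlt⟩⟩
  · exact absurd he.le hle
  · exact absurd hlt.le hle
  · exact ⟨k, α, r, hloop, hlt⟩

/-! ### Hammocks and boxes -/

theorem s_wordσ_of_head? {w : Word V A} {α : Syllable A} (h : w.toList.head? = some α) :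
    Λ.s w = Λ.sylSrc α ∧ Λ.wordσ w = Λ.sylσ α := by
  cases w with
  | one => simp [Word.toList] at h
  | path l hl =>
    obtain rfl : l.head hl = α := by
      rwa [Word.toList, List.head?_eq_some_head hl, Option.some_inj] at h
    exact ⟨rfl, rfl⟩

theorem t_wordε_of_getLast? {w : Word V A} {α : Syllable A} (h : w.toList.getLast? = some α) :
    Λ.t w = Λ.sylTgt α ∧ Λ.wordε w = Λ.sylε α := by
  cases w with
  | one => simp [Word.toList] at h
  | path l hl =>
    obtain rfl : l.getLast hl = α := by
      rwa [Word.toList, List.getLast?_eq_getLast_of_ne_nil hl, Option.some_inj] at h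
    exact ⟨rfl, rfl⟩

theorem toList_inv (w : Word V A) : w.inv.toList = w.toList.reverse.map Syllable.flip := by
  cases w <;> rfl

theorem s_inv (w : Word V A) : Λ.s w.inv = Λ.t w := by
  cases w with
  | one => rfl
  | path l h => simp [Word.inv, s, t, sylSrc_flip]

theorem wordσ_inv (w : Word V A) : Λ.wordσ w.inv = Λ.wordε w := by
  cases w with
  | one => simp [Word.inv, wordσ, wordε]
  | path l h => simp [Word.inv, wordσ, wordε, sylσ_flip]

theorem mem_Hl_one_iff {v : V} {x : LeftExt V A} :
    x ∈ Λ.Hl (.one v 1) ↔ ∃ w, x = .fin w ∧ Λ.IsString w ∧ Λ.s w = v ∧ Λ.wordσ w = -1 := by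
  constructor
  · rintro ⟨_, rfl, hw, u, hu, ⟨hs, hσ⟩, rfl⟩
    refine ⟨_, rfl, hw, ?_⟩
    cases u with
    | one v' i =>
      exact ⟨rfl, rfl⟩
    | path l h => exact ⟨hs, hσ (Or.inr rfl)⟩
  · rintro ⟨w, rfl, hw, hs, hσ⟩
    refine ⟨w, rfl, hw, w, hw, ⟨hs, fun _ => hσ⟩, ?_⟩
    cases w with
    | one v' i =>
      obtain rfl : v' = v := hs
      obtain rfl : i = 1 := neg_injective hσ
      rfl
    | path l h => rfl

theorem mem_Hr_one_iff {v : V} {x : RightExt V A} :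
    x ∈ Λ.Hr (.one v 1) ↔ ∃ w, x = .fin w ∧ Λ.IsString w ∧ Λ.t w = v ∧ Λ.wordε w = 1 := by
  constructor
  · rintro ⟨_, rfl, hw, u, hu, ⟨hs, hσ⟩, rfl⟩
    exact ⟨_, rfl, hw, hs.symm, (neg_injective (hσ (Or.inl rfl))).symm⟩
  · rintro ⟨w, rfl, hw, hs, hσ⟩
    refine ⟨w, rfl, hw, w, hw, ⟨hs.symm, fun _ => ?_⟩, rfl⟩
    rw [hσ]
    rfl

/-- A right infinite string that changes its direction infinitely often is approximated, from
either side, by its initial parts. So one of them lies in any interval whose closure contains the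
infinite string. -/
theorem exists_take_mem_of_mem_intervalClosure {v : V} {J : Set (RightExt V A)}
    (hJ : J ⊆ Λ.Hr (.one v 1)) {g : Stream' (Syllable A)}
    (hdir : ∀ k, ∃ m ≥ k, (g.get m).IsDirect) (hinv : ∀ k, ∃ m ≥ k, (g.get m).IsInverse)
    (hg : .inf g ∈ intervalClosure (Λ.HrHat (.one v 1)) (Λ.Hr (.one v 1)) J) :
    ∃ (m : ℕ) (w : Word V A), 0 < m ∧ w.toList = (g.take m).reverse ∧ .fin w ∈ J := by
  obtain ⟨hgm, z, hz, hzJ⟩ := hg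
  obtain ⟨w', rfl, hw', ht', hε'⟩ := mem_Hr_one_iff.1 (hJ hz)
  obtain ⟨_, h, -⟩ | ⟨⟨f, hf, hgs⟩, f', hf', hfv, hfε⟩ := hgm
  · cases h
  obtain rfl := RightExt.inf.inj hf
  obtain rfl := RightExt.inf.inj hf'
  have hgc : Λ.IsCoherent v 1 (RightExt.inf g).inv := by
    have := isCoherent_inf (Λ := Λ) (f := g.map Syllable.flip) fun n => by
      have := (hgs n).inv
      rwa [List.reverse_reverse, Stream'.map_take] at this
    have hh : (g.map Syllable.flip).head = g.head.flip := rfl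
    rwa [hh, sylSrc_flip, sylσ_flip, hfv, hfε] at this
  have hwc : Λ.IsCoherent v 1 (RightExt.fin w').inv := by
    refine isCoherent_fin ?_ ((s_inv w').trans ht') ((wordσ_inv w').trans hε')
    rw [IsString, toList_inv]
    exact IsStringList.inv hw'
  -- The initial part of length `m`, and its position relative to the infinite string.
  have part : ∀ m, 0 < m → ∃ w : Word V A, w.toList = (g.take m).reverse ∧
      .fin w ∈ Λ.Hr (.one v 1) ∧
      (∀ j < m, (RightExt.fin w).inv.syl j = (RightExt.inf g : RightExt V A).inv.syl j) ∧
      (RightExt.fin w).inv.syl m = none := by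
    intro m hm
    have hne : (g.take m).reverse ≠ [] := by
      intro h
      have := congrArg List.length h
      simp at this
      omega
    have hlist : (Word.path (V := V) (g.take m).reverse hne).inv.toList =
        (g.take m).map Syllable.flip := by
      rw [toList_inv, Word.toList, List.reverse_reverse]
    refine ⟨.path _ hne, rfl, mem_Hr_one_iff.2 ⟨_, rfl, hgs m, ?_⟩, fun j hj => ?_, ?_⟩
    · have hlast : (Word.path (V := V) (g.take m).reverse hne).toList.getLast? = some g.head := by
        obtain ⟨m, rfl⟩ := Nat.exists_eq_succ_of_ne_zero hm.ne'
        rw [Word.toList, List.getLast?_reverse, Stream'.take_succ, List.head?_cons]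
      obtain ⟨h₁, h₂⟩ := t_wordε_of_getLast? (Λ := Λ) hlast
      exact ⟨h₁.trans hfv, h₂.trans hfε⟩
    · rw [RightExt.inv, LeftExt.syl_fin, hlist, List.getElem?_map, Stream'.getElem?_take hj]
      rfl
    · rw [RightExt.inv, LeftExt.syl_fin, hlist]
      simp
  rcases hgc.trichotomy hwc with he | hlt | hlt
  · have := he w'.inv.toList.length
    rw [RightExt.inv, RightExt.inv, LeftExt.syl_fin, List.getElem?_eq_none le_rfl] at this
    cases this
  · obtain ⟨k, hk, hr⟩ := hlt
    obtain ⟨m, hm, hd⟩ := hinv (k + 1)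
    obtain ⟨w, hw, hwH, hag, hend⟩ := part m (by omega)
    refine ⟨m, w, by omega, hw, hzJ (Or.inl ⟨hwH, ?_, ?_⟩)⟩
    · refine (RightExt.lt_iff_inv_lt.2 (LeftExt.SLt.lt ⟨m, fun j hj => (hag j hj).symm, ?_⟩)).le
      rw [hend, RightExt.inv, LeftExt.syl_inf, Stream'.get_map]
      revert hd
      cases g.get m <;> simp [Syllable.IsInverse, Syllable.flip, LeftExt.rank]
    · exact (RightExt.lt_iff_inv_lt.2 (LeftExt.SLt.of_agree_left hk hr
        fun j hj => hag j (by omega)).lt).le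
  · obtain ⟨k, hk, hr⟩ := hlt
    obtain ⟨m, hm, hd⟩ := hdir (k + 1)
    obtain ⟨w, hw, hwH, hag, hend⟩ := part m (by omega)
    refine ⟨m, w, by omega, hw, hzJ (Or.inr ⟨hwH, ?_, ?_⟩)⟩
    · exact (RightExt.lt_iff_inv_lt.2 (LeftExt.SLt.of_agree_right hk hr
        fun j hj => hag j (by omega)).lt).le
    · refine (RightExt.lt_iff_inv_lt.2 (LeftExt.SLt.lt ⟨m, hag, ?_⟩)).le
      rw [hend, RightExt.inv, LeftExt.syl_inf, Stream'.get_map]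
      revert hd
      cases g.get m <;> simp [Syllable.IsDirect, Syllable.flip, LeftExt.rank]

/-- Two loops that branch off from each other after `c` generate a binary tree of strings: a node
is a product of the two loops, followed by `c`. If these strings, continued on the right by a fixed
string, lie in a box, then the box is not scattered. -/
theorem not_isScattered_of_isLoop {v : V} {X : Set (LeftExt V A × RightExt V A)}
    (hX : Λ.IsBox v X) {l : List (Syllable A)} (hl : Λ.IsBandList l)
    {c r₀ r₁ e : List (Syllable A)} {α β : Syllable A} (h₀ : Λ.IsLoop l (c ++ α :: r₀))
    (h₁ : Λ.IsLoop l (c ++ β :: r₁)) (hα : LeftExt.rank (some α) < 0)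
    (hβ : 0 < LeftExt.rank (some β)) {L : List (List (Syllable A))} (hL : ∀ x ∈ L, Λ.IsLoop l x)
    {w : Word V A} (hw : w.toList ≠ []) (he : e ≠ []) (hwe : w.toList ++ e <:+ L.flatten)
    (hwX : .fin w ∈ Prod.snd '' X)
    (hu : ∀ (u : Word V A) (r : List (Syllable A)), u.toList = e ++ r → Λ.IsString u →
      .fin u ∈ Prod.fst '' X) : ¬ IsScattered X := by
  obtain ⟨w', hw', hws, hwt, hwε⟩ := mem_Hr_one_iff.1 (hX.2.2.1.1 hwX)
  obtain rfl := RightExt.fin.inj hw'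
  let P : Bool → List (Syllable A) := fun a => cond a (c ++ β :: r₁) (c ++ α :: r₀)
  have hP : ∀ a, Λ.IsLoop l (P a) := by rintro (_ | _) <;> assumption
  let q : List Bool → List (Syllable A) := fun x => e ++ ((x.map P).flatten ++ c)
  have hq : ∀ x, q x ≠ [] := fun x h => he (List.append_eq_nil_iff.1 h).1
  have hstr : ∀ x, Λ.IsStringList (w.toList ++ q x) := by
    intro x
    have := (isStringList_flatten_append hl (L := L ++ x.map P) (by
      intro y hy
      rcases List.mem_append.1 hy with hy | hy
      · exact hL y hy
      · obtain ⟨a, -, rfl⟩ := List.mem_map.1 hy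
        exact hP a) h₀.string h₀.head).1
    obtain ⟨z, hz⟩ := hwe
    rw [List.flatten_append, ← hz] at this
    exact this.infix ⟨z, α :: r₀, by simp [q]⟩
  refine not_isScattered_of_binary_tree (fun x => (.fin (.path (q x) (hq x)), .fin w))
    (fun x => ?_) (fun x y => ?_) (fun x y => ?_)
  · have hux : Λ.IsString (.path (q x) (hq x)) :=
      (hstr x).infix ⟨w.toList, [], by simp [Word.toList]⟩
    have huX := hu (.path (q x) (hq x)) _ rfl hux
    obtain ⟨u, hu', -, hus, huσ⟩ := mem_Hl_one_iff.1 (hX.2.1.1 huX)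
    obtain rfl := LeftExt.fin.inj hu'
    rw [hX.2.2.2]
    refine ⟨⟨_, w, rfl, hux, hws, hus, hwt.symm, hwε, by rw [huσ, neg_neg], ?_, ?_⟩, huX, hwX⟩
    · exact composable_of_toList_ne_nil (hq x) hw (hstr x)
    · rw [IsString, Word.toList_comp]
      exact hstr x
  · refine Prod.mk_lt_mk_iff_left.2 (LeftExt.lt_of_direct (α := α)
      (r := r₀ ++ ((y.map P).flatten ++ c)) hα ?_ rfl)
    simp [q, P, Word.toList]
  · refine Prod.mk_lt_mk_iff_left.2 (LeftExt.lt_of_inverse (α := β)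
      (r := r₁ ++ ((y.map P).flatten ++ c)) hβ ?_ rfl)
    simp [q, P, Word.toList]

/-! ### Exceptional points -/

theorem append_replicate_flatten_append (s t : List (Syllable A)) (n : ℕ) :
    s ++ ((List.replicate n (t ++ s)).flatten ++ t) =
      (List.replicate (n + 1) (s ++ t)).flatten := by
  induction n with
  | zero => simp
  | succ n ih =>
    rw [List.replicate_succ, List.flatten_cons, List.replicate_succ (n := n + 1),
      List.flatten_cons, ← ih]
    simp

theorem exists_ge_get_cycle_eq {l : List (Syllable A)} (hl : l ≠ []) {α : Syllable A} (hα : α ∈ l)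
    (k : ℕ) : ∃ m ≥ k, (Stream'.cycle l hl).get m = α := by
  obtain ⟨j, hj⟩ := Stream'.mem_iff_exists_get_eq.1 (Stream'.mem_cycle hl hα)
  refine ⟨j + k * l.length, ?_, ?_⟩
  · have := Nat.le_mul_of_pos_right k (List.length_pos_of_ne_nil hl)
    omega
  · rw [hj]
    exact (Stream'.periodic_get_cycle hl).nat_mul k j

theorem IsBandList.exists_isDirect {l : List (Syllable A)} (hl : Λ.IsBandList l) :
    (∃ α ∈ l, α.IsDirect) ∧ ∃ β ∈ l, β.IsInverse := by
  obtain ⟨h₁, h₂, -⟩ := hl.peak _ (List.getLast?_eq_getLast_of_ne_nil hl.ne_nil) _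
    (List.head?_eq_some_head hl.ne_nil)
  exact ⟨⟨_, List.getLast_mem _, h₁⟩, ⟨_, List.head_mem _, h₂⟩⟩

/-- Suppose that the closure of a box `X` contains the point of the cycle `t s`, a rotation of the
band `s t`, so that the left closure contains all strings between the left infinite power of the
cycle and some `z`. If a loop at the band branches off from the infinite power of the band towards
the side of `z`, then `X` is not scattered. -/
theorem not_isScattered_of_branch {v : V} {X : Set (LeftExt V A × RightExt V A)}
    (hX : Λ.IsBox v X) {s t : List (Syllable A)} (hl : Λ.IsBandList (s ++ t)) (hts : t ++ s ≠ [])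
    (hts' : (t ++ s).reverse ≠ [])
    (hleft : .inf (Stream'.cycle (t ++ s) hts) ∈ Λ.HlHat (.one v 1))
    (hright : .inf (Stream'.cycle (t ++ s).reverse hts') ∈
      intervalClosure (Λ.HrHat (.one v 1)) (Λ.Hr (.one v 1)) (Prod.snd '' X))
    {z : LeftExt V A}
    (hz : {y | y ∈ Λ.Hl (.one v 1) ∧ .inf (Stream'.cycle (t ++ s) hts) ≤ y ∧ y ≤ z} ∪
      {y | y ∈ Λ.Hl (.one v 1) ∧ z ≤ y ∧ y ≤ .inf (Stream'.cycle (t ++ s) hts)} ⊆ Prod.fst '' X)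
    {k : ℕ} {α : Syllable A} {r : List (Syllable A)}
    (hloop : Λ.IsLoop (s ++ t) ((Stream'.cycle (s ++ t) hl.ne_nil).take k ++ (α :: r)))
    (hbr : LeftExt.rank (some ((Stream'.cycle (s ++ t) hl.ne_nil).get k)) <
        LeftExt.rank (some α) ∧ (LeftExt.inf (Stream'.cycle (t ++ s) hts)).SLt z ∨
      LeftExt.rank (some α) < LeftExt.rank (some ((Stream'.cycle (s ++ t) hl.ne_nil).get k)) ∧
        z.SLt (.inf (Stream'.cycle (t ++ s) hts))) : ¬ IsScattered X := by
  set l := s ++ t with hldef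
  set f := Stream'.cycle (t ++ s) hts with hf
  set F := Stream'.cycle l hl.ne_nil with hF
  have hrep : ∀ n, ∀ x ∈ List.replicate n l, Λ.IsLoop l x :=
    fun n x hx => (List.eq_of_mem_replicate hx) ▸ hl.isLoop
  -- The truncation of the right infinite power.
  obtain ⟨m, w, hm, hw, hwX⟩ := exists_take_mem_of_mem_intervalClosure hX.2.2.1.1
    (fun k => by
      obtain ⟨α, hα, hd⟩ := hl.exists_isDirect.1
      obtain ⟨m, hm, he⟩ := exists_ge_get_cycle_eq hts' (α := α)
        (by simpa [hldef, or_comm] using hα) k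
      exact ⟨m, hm, he.symm ▸ hd⟩)
    (fun k => by
      obtain ⟨α, hα, hd⟩ := hl.exists_isDirect.2
      obtain ⟨m, hm, he⟩ := exists_ge_get_cycle_eq hts' (α := α)
        (by simpa [hldef, or_comm] using hα) k
      exact ⟨m, hm, he.symm ▸ hd⟩) hright
  have hwne : w.toList ≠ [] := by
    intro h
    have := congrArg List.length (hw.symm.trans h)
    simp at this
    omega
  obtain ⟨r', hr'⟩ : ∃ r', (List.replicate m (t ++ s)).flatten = r' ++ w.toList := by
    obtain ⟨r', hr'⟩ := exists_replicate_eq_take hts' m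
    refine ⟨r'.reverse, ?_⟩
    have := congrArg List.reverse hr'
    rw [(List.reverse_append : (_ ++ r').reverse = _), ← hw, List.reverse_flatten] at this
    rw [← this, List.map_replicate, List.reverse_replicate, List.reverse_reverse]
  -- The loop that follows the band beyond the branching point.
  obtain ⟨r₀, hr₀⟩ : ∃ r₀ : List (Syllable A), Λ.IsLoop l (F.take k ++ (F.get k :: r₀)) := by
    obtain ⟨r₀, hr₀⟩ := exists_replicate_eq_take hl.ne_nil (k + 1)
    obtain ⟨h₁, h₂⟩ := isStringList_flatten_append hl (hrep (k + 1)) hl.string rfl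
    have h₃ := List.getLast?_append_of_ne_nil (List.replicate (k + 1) l).flatten hl.ne_nil
    refine ⟨r₀ ++ l, ?_⟩
    rw [hr₀, Stream'.take_succ'] at h₁ h₂ h₃
    have he : F.take k ++ (F.get k :: (r₀ ++ l)) = F.take k ++ [F.get k] ++ r₀ ++ l := by
      rw [List.append_assoc, List.append_assoc]; rfl
    rw [he]
    exact ⟨h₁, h₂, h₃⟩
  have hfF : ∀ n, f = (t ++ (List.replicate n l).flatten) ++ₛ F := by
    intro n
    rw [Stream'.append_append_stream, ← Stream'.cycle_eq_replicate_append hl.ne_nil n]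
    exact Stream'.cycle_append_comm hl.ne_nil hts
  -- The number of copies of the band needed to pass the first difference from `z`.
  obtain ⟨n, hn, hz'⟩ : ∃ n, 0 < n ∧
      (LeftExt.rank (some (F.get k)) < LeftExt.rank (some α) ∧
        (∀ y, (∀ j < n, y.syl j = (LeftExt.inf f).syl j) → y < z) ∨
      LeftExt.rank (some α) < LeftExt.rank (some (F.get k)) ∧
        (∀ y, (∀ j < n, y.syl j = (LeftExt.inf f).syl j) → z < y)) := by
    rcases hbr with ⟨hlt, i, hi, hr⟩ | ⟨hlt, i, hi, hr⟩
    · exact ⟨i + 1, by omega, Or.inl ⟨hlt, fun y hy =>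
        (LeftExt.SLt.of_agree_left hi hr fun j hj => hy j (by omega)).lt⟩⟩
    · exact ⟨i + 1, by omega, Or.inr ⟨hlt, fun y hy =>
        (LeftExt.SLt.of_agree_right hi hr fun j hj => hy j (by omega)).lt⟩⟩
  set q := t ++ (List.replicate n l).flatten with hq
  have hqlen : n ≤ q.length := by
    rw [hq, List.length_append, List.length_flatten, List.map_replicate, List.sum_replicate,
      smul_eq_mul]
    have := Nat.le_mul_of_pos_right n (List.length_pos_of_ne_nil hl.ne_nil)
    omega
  have hfq : f = (q ++ F.take k) ++ₛ F.drop k := by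
    rw [Stream'.append_append_stream, Stream'.append_take_drop]
    exact hfF n
  have hfget : (LeftExt.inf f : LeftExt V A).syl (q ++ F.take k).length = some (F.get k) := by
    rw [LeftExt.syl_inf, hfq, Stream'.get_append_length, Stream'.get_drop]
    rfl
  have hfst : ∀ (u : Word V A) (r₁ : List (Syllable A)),
      u.toList = (q ++ (F.take k ++ (α :: r))) ++ r₁ → Λ.IsString u → .fin u ∈ Prod.fst '' X := by
    intro u r₁ hur hu
    have hur' : u.toList = (q ++ F.take k) ++ α :: (r ++ r₁) := by rw [hur]; simp
    have hag : ∀ j < (q ++ F.take k).length,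
        (LeftExt.fin u).syl j = (LeftExt.inf f : LeftExt V A).syl j := by
      intro j hj
      rw [hfq]
      exact LeftExt.syl_fin_append hur' _ hj
    have hagn : ∀ j < n, (LeftExt.fin u).syl j = (LeftExt.inf f : LeftExt V A).syl j :=
      fun j hj => hag j (by rw [List.length_append]; omega)
    have huH : .fin u ∈ Λ.Hl (.one v 1) := by
      obtain ⟨_, h, -⟩ | ⟨-, f', hf', hfv, hfσ⟩ := hleft
      · cases h
      · obtain rfl := LeftExt.inf.inj hf'
        have hhead : u.toList.head? = some f.head := by
          rw [List.head?_eq_getElem?]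
          exact hagn 0 hn
        obtain ⟨h₁, h₂⟩ := s_wordσ_of_head? (Λ := Λ) hhead
        exact mem_Hl_one_iff.2 ⟨u, rfl, hu, h₁.trans hfv, h₂.trans (by rw [hfσ, neg_neg])⟩
    have hget := LeftExt.syl_fin_append_cons hur'
    rcases hz' with ⟨hlt, hz'⟩ | ⟨hlt, hz'⟩
    · refine hz (Or.inl ⟨huH, (LeftExt.SLt.lt ⟨_, fun j hj => (hag j hj).symm, ?_⟩).le,
        (hz' _ hagn).le⟩)
      rw [hget, hfget]
      exact hlt
    · refine hz (Or.inr ⟨huH, (hz' _ hagn).le, (LeftExt.SLt.lt ⟨_, hag, ?_⟩).le⟩)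
      rw [hget, hfget]
      exact hlt
  have hL : ∀ x ∈ List.replicate (m + 1) l ++ (List.replicate n l ++ [F.take k ++ (α :: r)]),
      Λ.IsLoop l x := by
    intro x hx
    simp only [List.mem_append, List.mem_singleton] at hx
    rcases hx with hx | hx | rfl
    · exact hrep _ x hx
    · exact hrep _ x hx
    · exact hloop
  have hsuff : w.toList ++ (q ++ (F.take k ++ (α :: r))) <:+
      (List.replicate (m + 1) l ++ (List.replicate n l ++ [F.take k ++ (α :: r)])).flatten := by
    refine ⟨s ++ r', ?_⟩
    rw [List.flatten_append, ← append_replicate_flatten_append, hr']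
    simp [hq]
  have hne : q ++ (F.take k ++ (α :: r)) ≠ [] := by simp
  rcases hz' with ⟨hlt, -⟩ | ⟨hlt, -⟩
  · exact not_isScattered_of_isLoop hX hl hr₀ hloop (LeftExt.rank_some_lt hlt).1
      (LeftExt.rank_some_lt hlt).2 hL hwne hne hsuff hwX hfst
  · exact not_isScattered_of_isLoop hX hl hloop hr₀ (LeftExt.rank_some_lt hlt).1
      (LeftExt.rank_some_lt hlt).2 hL hwne hne hsuff hwX hfst

/-- A band that is extremal on neither side has loops branching off to both sides, so no scattered
box has the point of one of its rotations in its closure. -/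
theorem mem_iUnion_of_isExceptional {Q₀ : Set (Word V A)} (hQ₀ : Λ.IsBandTransversal Q₀) {v : V}
    {b₁ b : Word V A} (hb : b ∈ Q₀) (hperm : b₁.IsCyclicPerm b)
    (hexc : Λ.IsExceptional Q₀ v (point b₁)) :
    b ∈ ⋃ B ∈ Λ.QBa Q₀, (Λ.Bal B ∪ Λ.BalBar B) := by
  have hbb := hQ₀.1 b hb
  have hl := hbb.isBandList
  have hB : {b' | b' ∈ Q₀ ∧ Λ.Reaches b b' ∧ Λ.Reaches b' b} ∈ Λ.QBa Q₀ := ⟨b, hb, rfl⟩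
  have hbB : b ∈ {b' | b' ∈ Q₀ ∧ Λ.Reaches b b' ∧ Λ.Reaches b' b} :=
    ⟨hb, .refl hbb, .refl hbb⟩
  by_contra hnot
  have hnBal : b ∉ Λ.Bal {b' | b' ∈ Q₀ ∧ Λ.Reaches b b' ∧ Λ.Reaches b' b} :=
    fun h => hnot (Set.mem_biUnion hB (Or.inl h))
  have hnBalBar : b ∉ Λ.BalBar {b' | b' ∈ Q₀ ∧ Λ.Reaches b b' ∧ Λ.Reaches b' b} :=
    fun h => hnot (Set.mem_biUnion hB (Or.inr h))
  obtain ⟨k, α, r, hloop, hlt⟩ := exists_branch_lt_of_not_mem_Bal hQ₀ hB hbB hl hnBal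
  obtain ⟨k', α', r', hloop', hgt⟩ := exists_branch_gt_of_not_mem_BalBar hQ₀ hB hbB hl hnBalBar
  obtain ⟨hne, hrot⟩ := hperm
  obtain ⟨i, hi, hrot⟩ := List.isRotated_iff_mod.1 hrot
  rw [List.rotate_eq_drop_append_take hi] at hrot
  generalize hs : b₁.toList.drop i = s at hrot
  generalize ht : b₁.toList.take i = t at hrot
  have hts : b₁.toList = t ++ s := by rw [← hs, ← ht, List.take_append_drop]
  generalize b.toList = l at *
  subst hrot
  obtain ⟨-, -, X, hX, hsc, hmem⟩ := hexc
  have hts₁ : t ++ s ≠ [] := hts ▸ hne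
  have hts₂ : (t ++ s).reverse ≠ [] := fun h => hts₁ (List.reverse_eq_nil_iff.1 h)
  have hpoint : point b₁ = (.inf (Stream'.cycle (t ++ s) hts₁),
      .inf (Stream'.cycle (t ++ s).reverse hts₂)) := by
    rw [Word.eq_path_of_toList_ne_nil hne]
    simp only [hts]
    rfl
  rw [hpoint] at hmem
  obtain hmem | ⟨-, -, ⟨hleft, z, hzX, hz⟩, hright⟩ := hmem
  · obtain ⟨u, w, h, -⟩ := hX.1 hmem
    cases h
  obtain ⟨w, rfl, hw, hws, hwσ⟩ := mem_Hl_one_iff.1 (hX.2.1.1 hzX)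
  have hcoh : Λ.IsCoherent v (-1) (.inf (Stream'.cycle (t ++ s) hts₁)) := by
    obtain ⟨_, h, -⟩ | ⟨⟨f, hf, hfs⟩, f', hf', hfv, hfσ⟩ := id hleft
    · cases h
    · obtain rfl := LeftExt.inf.inj hf
      obtain rfl := LeftExt.inf.inj hf'
      have := isCoherent_inf hfs
      rwa [hfv, show Λ.sylσ _ = -1 from (neg_eq_iff_eq_neg.1 hfσ.symm)] at this
  rcases hcoh.trichotomy (isCoherent_fin hw hws hwσ) with he | hzl | hzl
  · have := he w.toList.length
    rw [LeftExt.syl_fin, List.getElem?_eq_none le_rfl] at this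
    cases this
  · exact not_isScattered_of_branch hX hl hts₁ hts₂ hleft hright hz hloop'
      (Or.inl ⟨hgt, hzl⟩) hsc
  · exact not_isScattered_of_branch hX hl hts₁ hts₂ hleft hright hz hloop
      (Or.inr ⟨hlt, hzl⟩) hsc

end StringAlgebra

theorem mainTheorem7 {V A : Type*} [Finite V] [Finite A] (Λ : StringAlgebra V A)
    (Q₀ : Set (Word V A)) (hQ₀ : Λ.IsBandTransversal Q₀) (v : V) :
    (⋃ B ∈ Λ.QBa Q₀, (Λ.Bal B ∪ Λ.BalBar B)).Finite ∧
    (∀ b₁ ∈ Λ.CycAt Q₀ v, ∀ b ∈ Q₀, b₁.IsCyclicPerm b →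
      Λ.IsExceptional Q₀ v (StringAlgebra.point b₁) →
      b ∈ ⋃ B ∈ Λ.QBa Q₀, (Λ.Bal B ∪ Λ.BalBar B)) ∧
    {p | p ∈ Λ.HBar Q₀ v \ Λ.H v ∧ Λ.IsExceptional Q₀ v p}.Finite := by
  have hfin := StringAlgebra.finite_iUnion_Bal_union_BalBar hQ₀
  refine ⟨hfin, fun b₁ _ b hb hperm hexc =>
    StringAlgebra.mem_iUnion_of_isExceptional hQ₀ hb hperm hexc, ?_⟩
  -- A band has finitely many cyclic permutations.
  have hcyc : ∀ b : Word V A, {b₁ : Word V A | b₁.IsCyclicPerm b}.Finite := by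
    intro b
    refine Set.Finite.of_finite_image (f := Word.toList)
      ((List.finite_toSet b.toList.cyclicPermutations).subset ?_) ?_
    · rintro _ ⟨b₁, h, rfl⟩
      exact List.mem_cyclicPermutations_iff.2 h.2
    · intro x hx y hy h
      rw [Word.eq_path_of_toList_ne_nil hx.1, Word.eq_path_of_toList_ne_nil hy.1]
      simp only [h]
  refine ((hfin.biUnion fun b _ => hcyc b).image StringAlgebra.point).subset ?_
  rintro p ⟨-, hexc⟩
  obtain ⟨b₁, ⟨b, hb, hperm⟩, rfl⟩ := hexc.2.1
  exact ⟨b₁, Set.mem_biUnion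
    (StringAlgebra.mem_iUnion_of_isExceptional hQ₀ hb hperm hexc) hperm, rfl⟩
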